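/- Let $a=\xi_0<\xi_1<\dots<\xi_n<\xi_{n+1}=b$, and consider the boundary value transmission problem $$-\rho(x)u''(x)+q(x)u(x)=\lambda u(x),\qquad x\in\bigcup_{k=0}^{n}(\xi_k,\xi_{k+1}),$$ $$\delta_1u(a)-\delta_2u'(a)-\lambda(\delta_3u(a)-\delta_4u'(a))=0,\qquad \gamma_1u(b)-\gamma_2u'(b)+\lambda(\gamma_3u(b)-\gamma_4u'(b))=0,$$ $$\delta_{i1}^-u'(\xi_i-)+\delta_{i0}^-u(\xi_i-)+\delta_{i1}^+u'(\xi_i+)+\delta_{i0}^+u(\xi_i+)=0,\qquad \gamma_{i1}^-u'(\xi_i-)+\gamma_{i0}^-u(\xi_i-)+\gamma_{i1}^+u'(\xi_i+)+\gamma_{i0}^+u(\xi_i+)=0\quad(1\le i\le n),$$ where all coefficients are real, $\lambda$ is a complex parameter, $\rho(x)=\rho_{k+1}^2>0$ on $(\xi_k,\xi_{k+1})$, and $q$ is real-valued, continuous on each $(\xi_k,\xi_{k+1})$, with finite one-sided limits at the end points of these intervals. Values of functions at $a$, $b$ and $\xi_i\pm$ are one-sided limits. An eigenfunction (with eigenvalue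 $\lambda$) is a solution $u$ that does not vanish identically, $u$ and $u'$ having finite one-sided limits at the end points of the intervals. Let $\theta_{ijk}$ $(1\le j<k\le4)$ be the determinant of the $j$-th and $k$-th columns of $$\begin{pmatrix}\delta_{i1}^+&\delta_{i0}^+&\delta_{i1}^-&\delta_{i0}^-\\ \gamma_{i1}^+&\gamma_{i0}^+&\gamma_{i1}^-&\gamma_{i0}^-\end{pmatrix},$$ and let $\kappa_1=\delta_3\delta_2-\delta_4\delta_1$, $\kappa_2=\gamma_3\gamma_2-\gamma_4\gamma_1$. Assume that $\theta_{ijk}>0$ for all $i,j,k$ and that $\kappa_1,\kappa_2>0$. Put $$B_a[f]=\delta_1f(a)-\delta_2f'(a),\quad B_a'[f]=\delta_3f(a)-\delta_4f'(a),\quad B_b[f]=\gamma_1f(b)-\gamma_2f'(b),\quad B_b'[f]=\gamma_3f(b)-\gamma_4f'(b).$$ Let $\mathcal H=\bigoplus_{k=0}^nL_2(\xi_k,\xi_{k+1})\oplus\mathbb C^2$ be the Hilbert space with the inner product $$\langle(f,f_1,f_2),(g,g_1,g_2)\rangle_{\mathcal H}=\sum_{k=0}^{n}\frac1{\rho_{k+1}^2}\prod_{i=1}^{k}\theta_{i12}\prod_{i=k+1}^{n}\theta_{i34}\int_{\xi_k}^{\xi_{k+1}}f\,\overline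 g\,dx+\prod_{i=1}^n\theta_{i34}\,\frac{f_1\overline{g_1}}{\kappa_1}+\prod_{i=1}^n\theta_{i12}\,\frac{f_2\overline{g_2}}{\kappa_2}.$$ Let $\mathfrak R$ be the operator in $\mathcal H$ whose domain consists of the elements $(f,B_a'[f],-B_b'[f])$ such that $f$ and $f'$ are locally absolutely continuous on each $(\xi_k,\xi_{k+1})$ and have finite one-sided limits at the end points of these intervals, $-\rho f''+qf$ is square integrable, and $f$ satisfies the transmission conditions, and which acts by $$\mathfrak R(f,B_a'[f],-B_b'[f])=(-\rho f''+qf,\;B_a[f],\;B_b[f]).$$ Then the eigenfunctions $F\ne0$ of $\mathfrak R$ are exactly the elements $(u,B_a'[u],-B_b'[u])$ of $\mathcal H$ with $u$ an eigenfunction of the boundary value transmission problem, and they are complete in $\mathcal H$: maximal orthonormal sets of eigenfunctions of $\mathfrak R$ exist, and every such set is countably infinite and has dense linear span. If it is enumerated without repetition as $\{\Psi_s=(\Psi_s(x),B_a'[\Psi_s],-B_b'[\Psi_s]) : s\in\mathbb N\}$, with $\Psi_s(x)$ eigenfunctions of the boundary value transmission problem, then for every $(f,f_1,f_2)\in\mathcal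 H$ $$(f,f_1,f_2)=\sum_{s}\Big\{\sum_{k=0}^{n}\frac1{\rho_{k+1}^2}\prod_{i=1}^{k}\theta_{i12}\prod_{i=k+1}^{n}\theta_{i34}\int_{\xi_k}^{\xi_{k+1}}f(x)\overline{\Psi_s(x)}\,dx+\prod_{i=1}^n\theta_{i34}\frac{f_1\overline{B_a'[\Psi_s]}}{\kappa_1}+\prod_{i=1}^n\theta_{i12}\frac{f_2\overline{(-B_b'[\Psi_s])}}{\kappa_2}\Big\}\Psi_s,$$ where the series converges (unconditionally) in the norm of $\mathcal H$. -/

import Mathlib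

open MeasureTheory Filter Set Topology
open scoped ComplexConjugate

/-- The determinant of the `j`-th and `k`-th columns of a `2 × 4` matrix. -/
def colMinor (M : Matrix (Fin 2) (Fin 4) ℝ) (j k : Fin 4) : ℝ :=
  (M.submatrix id ![j, k]).det

/-- The data of the boundary value transmission problem
`-ρ u'' + q u = lam u` on `(ξ₀, ξ₁) ∪ ⋯ ∪ (ξₙ, ξₙ₊₁)`, where `a = ξ₀` and `b = ξₙ₊₁`.

The interval `(ξₖ, ξₖ₊₁)`, `k = 0, …, n`, has index `k : Fin (n + 1)`, and on it the leading
coefficient is `(ρ k) ^ 2`. The interior points are indexed by `i : Fin n`, the point of index `i`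
separating the intervals of index `i` and `i + 1`. The coefficient `δm i j` is the one of the
`j`-th derivative at the left side of the interior point `i` in the first transmission condition,
`δp i j` the one at the right side; `γm`, `γp` belong to the second transmission condition. -/
structure BVTProblem (n : ℕ) where
  ξ : Fin (n + 2) → ℝ
  ξ_strictMono : StrictMono ξ
  ρ : Fin (n + 1) → ℝ
  ρ_sq_pos : ∀ k, 0 < ρ k ^ 2
  q : ℝ → ℝ
  q_continuousOn : ∀ k : Fin (n + 1), ContinuousOn q (Ioo (ξ k.castSucc) (ξ k.succ))
  q_limit_right : ∀ k : Fin (n + 1), ∃ l : ℝ, Tendsto q (𝓝[>] (ξ k.castSucc)) (𝓝 l)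
  q_limit_left : ∀ k : Fin (n + 1), ∃ l : ℝ, Tendsto q (𝓝[<] (ξ k.succ)) (𝓝 l)
  δ₁ : ℝ
  δ₂ : ℝ
  δ₃ : ℝ
  δ₄ : ℝ
  γ₁ : ℝ
  γ₂ : ℝ
  γ₃ : ℝ
  γ₄ : ℝ
  δm : Fin n → Fin 2 → ℝ
  δp : Fin n → Fin 2 → ℝ
  γm : Fin n → Fin 2 → ℝ
  γp : Fin n → Fin 2 → ℝ
  θ_pos : ∀ (i : Fin n) (j k : Fin 4), j < k →
    0 < colMinor !![δp i 1, δp i 0, δm i 1, δm i 0; γp i 1, γp i 0, γm i 1, γm i 0] j k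
  κ₁_pos : 0 < (!![δ₃, δ₄; δ₁, δ₂]).det
  κ₂_pos : 0 < (!![γ₃, γ₄; γ₁, γ₂]).det

namespace BVTProblem

variable {n : ℕ} (P : BVTProblem n)

/-- The left end point `a = ξ₀`. -/
def a : ℝ := P.ξ 0

/-- The right end point `b = ξₙ₊₁`. -/
def b : ℝ := P.ξ (Fin.last (n + 1))

/-- The interior point with index `i`. -/
def node (i : Fin n) : ℝ := P.ξ i.succ.castSucc

/-- The interval `(ξₖ, ξₖ₊₁)`. -/
def interval (k : Fin (n + 1)) : Set ℝ := Ioo (P.ξ k.castSucc) (P.ξ k.succ)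

/-- The minors of the transmission matrix at the interior point `i`; columns are numbered
from zero, so that `P.θ i 0 1` is the minor of columns 1 and 2, `P.θ i 2 3` that of 3 and 4. -/
def θ (i : Fin n) (j k : Fin 4) : ℝ :=
  colMinor !![P.δp i 1, P.δp i 0, P.δm i 1, P.δm i 0;
    P.γp i 1, P.γp i 0, P.γm i 1, P.γm i 0] j k

def κ₁ : ℝ := (!![P.δ₃, P.δ₄; P.δ₁, P.δ₂]).det

def κ₂ : ℝ := (!![P.γ₃, P.γ₄; P.γ₁, P.γ₂]).det

/-- The weight of the interval `k` in the inner product: `1 / ρ ^ 2`, times the product of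
`θ i 0 1` over the interior points to the left of the interval, times the product of `θ i 2 3`
over the interior points to the right of it. -/
noncomputable def weight (k : Fin (n + 1)) : ℝ :=
  1 / P.ρ k ^ 2 *
    (∏ i ∈ Finset.univ.filter (fun i : Fin n => (i : ℕ) < (k : ℕ)), P.θ i 0 1) *
    ∏ i ∈ Finset.univ.filter (fun i : Fin n => (k : ℕ) ≤ (i : ℕ)), P.θ i 2 3

/-! ### Boundary and transmission functionals

Values at the end points and at the interior points are one-sided limits. -/

/-- `B_a[f] = δ₁ f(a) - δ₂ f'(a)`. -/
noncomputable def Ba (f : ℝ → ℂ) : ℂ :=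
  P.δ₁ * Function.rightLim f P.a - P.δ₂ * Function.rightLim (deriv f) P.a

/-- `B'_a[f] = δ₃ f(a) - δ₄ f'(a)`. -/
noncomputable def Ba' (f : ℝ → ℂ) : ℂ :=
  P.δ₃ * Function.rightLim f P.a - P.δ₄ * Function.rightLim (deriv f) P.a

/-- `B_b[f] = γ₁ f(b) - γ₂ f'(b)`. -/
noncomputable def Bb (f : ℝ → ℂ) : ℂ :=
  P.γ₁ * Function.leftLim f P.b - P.γ₂ * Function.leftLim (deriv f) P.b

/-- `B'_b[f] = γ₃ f(b) - γ₄ f'(b)`. -/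
noncomputable def Bb' (f : ℝ → ℂ) : ℂ :=
  P.γ₃ * Function.leftLim f P.b - P.γ₄ * Function.leftLim (deriv f) P.b

/-- The left-hand side of the first transmission condition. -/
noncomputable def trans₁ (i : Fin n) (f : ℝ → ℂ) : ℂ :=
  P.δm i 1 * Function.leftLim (deriv f) (P.node i) + P.δm i 0 * Function.leftLim f (P.node i) +
    P.δp i 1 * Function.rightLim (deriv f) (P.node i) + P.δp i 0 * Function.rightLim f (P.node i)

/-- The left-hand side of the second transmission condition. -/
noncomputable def trans₂ (i : Fin n) (f : ℝ → ℂ) : ℂ :=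
  P.γm i 1 * Function.leftLim (deriv f) (P.node i) + P.γm i 0 * Function.leftLim f (P.node i) +
    P.γp i 1 * Function.rightLim (deriv f) (P.node i) + P.γp i 0 * Function.rightLim f (P.node i)

/-- The differential expression `-ρ f'' + q f` on the interval `k`. -/
noncomputable def ell (k : Fin (n + 1)) (f : ℝ → ℂ) (x : ℝ) : ℂ :=
  -((P.ρ k : ℂ) ^ 2) * deriv (deriv f) x + P.q x * f x

/-- `f` and `f'` have finite one-sided limits at all end points of the intervals. -/
structure HasLimits (f : ℝ → ℂ) : Prop where
  right : ∀ k : Fin (n + 1), ∃ l : ℂ, Tendsto f (𝓝[>] (P.ξ k.castSucc)) (𝓝 l)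
  left : ∀ k : Fin (n + 1), ∃ l : ℂ, Tendsto f (𝓝[<] (P.ξ k.succ)) (𝓝 l)
  deriv_right : ∀ k : Fin (n + 1), ∃ l : ℂ, Tendsto (deriv f) (𝓝[>] (P.ξ k.castSucc)) (𝓝 l)
  deriv_left : ∀ k : Fin (n + 1), ∃ l : ℂ, Tendsto (deriv f) (𝓝[<] (P.ξ k.succ)) (𝓝 l)

/-- `u` is an eigenfunction, with eigenvalue `lam`, of the boundary value transmission problem. -/
structure IsEigenfunction (lam : ℂ) (u : ℝ → ℂ) : Prop where
  differentiableOn : ∀ k, DifferentiableOn ℝ u (P.interval k)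
  differentiableOn_deriv : ∀ k, DifferentiableOn ℝ (deriv u) (P.interval k)
  hasLimits : P.HasLimits u
  equation : ∀ k, ∀ x ∈ P.interval k, P.ell k u x = lam * u x
  boundary_a : P.Ba u - lam * P.Ba' u = 0
  boundary_b : P.Bb u + lam * P.Bb' u = 0
  transmission₁ : ∀ i, P.trans₁ i u = 0
  transmission₂ : ∀ i, P.trans₂ i u = 0
  nontrivial : ∃ k, ∃ x ∈ P.interval k, u x ≠ 0

/-! ### The Hilbert space -/

/-- The space `L₂(ξ₀, ξ₁) ⊕ ⋯ ⊕ L₂(ξₙ, ξₙ₊₁) ⊕ ℂ²`, to be equipped with the modified inner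
product. -/
def H : Type :=
  (∀ k : Fin (n + 1), Lp ℂ 2 (volume.restrict (P.interval k))) × ℂ × ℂ

noncomputable instance : AddCommGroup P.H :=
  inferInstanceAs
    (AddCommGroup ((∀ k : Fin (n + 1), Lp ℂ 2 (volume.restrict (P.interval k))) × ℂ × ℂ))

noncomputable instance : Module ℂ P.H :=
  inferInstanceAs
    (Module ℂ ((∀ k : Fin (n + 1), Lp ℂ 2 (volume.restrict (P.interval k))) × ℂ × ℂ))

variable {P} in
/-- The `L₂(ξₖ, ξₖ₊₁)` component of `F = (f, f₁, f₂)`. -/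
def H.fn (F : P.H) (k : Fin (n + 1)) : Lp ℂ 2 (volume.restrict (P.interval k)) := F.1 k

variable {P} in
/-- The component `f₁` of `F = (f, f₁, f₂)`. -/
def H.c₁ (F : P.H) : ℂ := F.2.1

variable {P} in
/-- The component `f₂` of `F = (f, f₁, f₂)`. -/
def H.c₂ (F : P.H) : ℂ := F.2.2

/-- The modified inner product `⟨F, G⟩`, linear in `F` and conjugate linear in `G`. -/
noncomputable def innerH (F G : P.H) : ℂ :=
  (∑ k, (P.weight k : ℂ) * (∫ x in P.interval k, F.fn k x * conj (G.fn k x))) +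
    ((∏ i, P.θ i 2 3 : ℝ) : ℂ) * (F.c₁ * conj G.c₁ / P.κ₁) +
    ((∏ i, P.θ i 0 1 : ℝ) : ℂ) * (F.c₂ * conj G.c₂ / P.κ₂)

theorem weight_pos (k : Fin (n + 1)) : 0 < P.weight k := by
  unfold weight
  have h1 : ∀ i, 0 < P.θ i 0 1 := fun i => P.θ_pos i 0 1 (by decide)
  have h2 : ∀ i, 0 < P.θ i 2 3 := fun i => P.θ_pos i 2 3 (by decide)
  have h3 := P.ρ_sq_pos k
  have h4 : 0 < ∏ i ∈ Finset.univ.filter (fun i : Fin n => (i : ℕ) < (k : ℕ)), P.θ i 0 1 := Finset.prod_pos fun i _ => h1 i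
  have h5 : 0 < ∏ i ∈ Finset.univ.filter (fun i : Fin n => (k : ℕ) ≤ (i : ℕ)), P.θ i 2 3 := Finset.prod_pos fun i _ => h2 i
  positivity

/-- The weight of the component `f₁` in the inner product. -/
noncomputable def weight₁ : ℝ := (∏ i, P.θ i 2 3) / P.κ₁

/-- The weight of the component `f₂` in the inner product. -/
noncomputable def weight₂ : ℝ := (∏ i, P.θ i 0 1) / P.κ₂

theorem weight₁_pos : 0 < P.weight₁ :=
  div_pos (Finset.prod_pos fun i _ => P.θ_pos i 2 3 (by decide)) P.κ₁_pos

theorem weight₂_pos : 0 < P.weight₂ :=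
  div_pos (Finset.prod_pos fun i _ => P.θ_pos i 0 1 (by decide)) P.κ₂_pos

theorem innerH_eq (F G : P.H) :
    P.innerH F G = (∑ k, (P.weight k : ℂ) * inner ℂ (G.fn k) (F.fn k)) +
      (P.weight₁ : ℂ) * inner ℂ G.c₁ F.c₁ + (P.weight₂ : ℂ) * inner ℂ G.c₂ F.c₂ := by
  simp only [innerH, L2.inner_def, RCLike.inner_apply, weight₁, weight₂]
  push_cast
  ring

variable {P} in
theorem H.ext {F G : P.H} (h : ∀ k, F.fn k = G.fn k) (h₁ : F.c₁ = G.c₁) (h₂ : F.c₂ = G.c₂) :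
    F = G :=
  Prod.ext (funext h) (Prod.ext h₁ h₂)

variable {P} in
@[simp] theorem H.fn_add (F G : P.H) (k : Fin (n + 1)) : (F + G).fn k = F.fn k + G.fn k := rfl
variable {P} in
@[simp] theorem H.c₁_add (F G : P.H) : (F + G).c₁ = F.c₁ + G.c₁ := rfl
variable {P} in
@[simp] theorem H.c₂_add (F G : P.H) : (F + G).c₂ = F.c₂ + G.c₂ := rfl
variable {P} in
@[simp] theorem H.fn_smul (c : ℂ) (F : P.H) (k : Fin (n + 1)) : (c • F).fn k = c • F.fn k := rfl
variable {P} in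
@[simp] theorem H.c₁_smul (c : ℂ) (F : P.H) : (c • F).c₁ = c * F.c₁ := rfl
variable {P} in
@[simp] theorem H.c₂_smul (c : ℂ) (F : P.H) : (c • F).c₂ = c * F.c₂ := rfl
variable {P} in
@[simp] theorem H.fn_zero (k : Fin (n + 1)) : (0 : P.H).fn k = 0 := rfl
variable {P} in
@[simp] theorem H.c₁_zero : (0 : P.H).c₁ = 0 := rfl
variable {P} in
@[simp] theorem H.c₂_zero : (0 : P.H).c₂ = 0 := rfl

theorem re_innerH_self (F : P.H) :
    (P.innerH F F).re =
      (∑ k, P.weight k * ‖F.fn k‖ ^ 2) + P.weight₁ * ‖F.c₁‖ ^ 2 + P.weight₂ * ‖F.c₂‖ ^ 2 := by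
  have h : P.innerH F F = (((∑ k, P.weight k * ‖F.fn k‖ ^ 2) + P.weight₁ * ‖F.c₁‖ ^ 2 +
      P.weight₂ * ‖F.c₂‖ ^ 2 : ℝ) : ℂ) := by
    rw [innerH_eq]
    simp only [inner_self_eq_norm_sq_to_K]
    push_cast
    rfl
  rw [h, Complex.ofReal_re]

/-- The modified inner product turns `P.H` into an inner product space. Mathlib's inner product
is conjugate linear in its first argument: `inner ℂ G F` is `⟨F, G⟩`. -/
@[reducible] noncomputable def innerCore : InnerProductSpace.Core ℂ P.H where
  inner G F := P.innerH F G
  conj_inner_symm F G := by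
    simp only [innerH_eq, map_add, map_sum, map_mul, Complex.conj_ofReal, inner_conj_symm]
  re_inner_nonneg F := by
    change 0 ≤ (P.innerH F F).re
    rw [re_innerH_self]
    have h := fun k => (P.weight_pos k).le
    have h₁ := P.weight₁_pos.le
    have h₂ := P.weight₂_pos.le
    have h₃ : 0 ≤ ∑ k, P.weight k * ‖F.fn k‖ ^ 2 :=
      Finset.sum_nonneg fun k _ => mul_nonneg (h k) (sq_nonneg _)
    positivity
  add_left F G K := by
    simp only [innerH_eq, H.fn_add, H.c₁_add, H.c₂_add, inner_add_left, mul_add,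
      Finset.sum_add_distrib]
    ring
  smul_left F G r := by
    simp only [innerH_eq, H.fn_smul, H.c₁_smul, H.c₂_smul, ← smul_eq_mul r,
      inner_smul_left, mul_add, Finset.mul_sum]
    congr 1
    · congr 1
      · exact Finset.sum_congr rfl fun k _ => by ring
      · ring
    · ring
  definite F hF := by
    have h0 : (P.innerH F F).re = 0 := by
      have : P.innerH F F = 0 := hF
      rw [this, Complex.zero_re]
    rw [re_innerH_self] at h0
    have h : ∀ k, 0 ≤ P.weight k * ‖F.fn k‖ ^ 2 :=
      fun k => mul_nonneg (P.weight_pos k).le (sq_nonneg _)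
    have hs := Finset.sum_nonneg fun k (_ : k ∈ Finset.univ) => h k
    have h₁ : 0 ≤ P.weight₁ * ‖F.c₁‖ ^ 2 := mul_nonneg P.weight₁_pos.le (sq_nonneg _)
    have h₂ : 0 ≤ P.weight₂ * ‖F.c₂‖ ^ 2 := mul_nonneg P.weight₂_pos.le (sq_nonneg _)
    have e : ∑ k, P.weight k * ‖F.fn k‖ ^ 2 = 0 := by linarith
    have e₁ : P.weight₁ * ‖F.c₁‖ ^ 2 = 0 := by linarith
    have e₂ : P.weight₂ * ‖F.c₂‖ ^ 2 = 0 := by linarith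
    refine H.ext (fun k => ?_) ?_ ?_
    · have := (Finset.sum_eq_zero_iff_of_nonneg fun k _ => h k).1 e k (Finset.mem_univ k)
      simpa [(P.weight_pos k).ne'] using this
    · simpa [P.weight₁_pos.ne'] using e₁
    · simpa [P.weight₂_pos.ne'] using e₂

noncomputable instance : NormedAddCommGroup P.H := P.innerCore.toNormedAddCommGroup

noncomputable instance : InnerProductSpace ℂ P.H := InnerProductSpace.ofCore P.innerCore.toCore

theorem inner_eq_innerH (F G : P.H) : inner ℂ G F = P.innerH F G := rfl

theorem norm_sq_eq (F : P.H) :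
    ‖F‖ ^ 2 = (∑ k, P.weight k * ‖F.fn k‖ ^ 2) + P.weight₁ * ‖F.c₁‖ ^ 2 +
      P.weight₂ * ‖F.c₂‖ ^ 2 := by
  rw [← re_innerH_self, ← inner_eq_innerH]
  exact InnerProductSpace.norm_sq_eq_re_inner (𝕜 := ℂ) F

instance : CompleteSpace P.H := by
  let e : P.H ≃ₗ[ℂ] ((∀ k : Fin (n + 1), Lp ℂ 2 (volume.restrict (P.interval k))) × ℂ × ℂ) :=
    LinearEquiv.refl ℂ _
  have aux : ∀ w x y : ℝ, 0 < w → 0 ≤ x → 0 ≤ y → w * x ^ 2 ≤ y ^ 2 → x ≤ (√w)⁻¹ * y := by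
    intro w x y hw hx hy h
    have hs := Real.sqrt_pos.2 hw
    rw [← div_eq_inv_mul, le_div_iff₀ hs]
    refine le_of_sq_le_sq ?_ hy
    rw [mul_pow, Real.sq_sqrt hw.le]
    linarith
  have hk0 : ∀ (F : P.H) k, 0 ≤ P.weight k * ‖F.fn k‖ ^ 2 :=
    fun F k => mul_nonneg (P.weight_pos k).le (sq_nonneg _)
  have h10 : ∀ F : P.H, 0 ≤ P.weight₁ * ‖F.c₁‖ ^ 2 :=
    fun F => mul_nonneg P.weight₁_pos.le (sq_nonneg _)
  have h20 : ∀ F : P.H, 0 ≤ P.weight₂ * ‖F.c₂‖ ^ 2 :=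
    fun F => mul_nonneg P.weight₂_pos.le (sq_nonneg _)
  have hS : 0 ≤ ∑ k, (√(P.weight k))⁻¹ := Finset.sum_nonneg fun k _ => by positivity
  let C : ℝ := (∑ k, (√(P.weight k))⁻¹) + (√P.weight₁)⁻¹ + (√P.weight₂)⁻¹
  have hC : 0 ≤ C := by positivity
  have b1 : ∀ F : P.H, ‖e F‖ ≤ C * ‖F‖ := by
    intro F
    have hn := P.norm_sq_eq F
    have hs := Finset.sum_nonneg fun k (_ : k ∈ Finset.univ) => hk0 F k
    have hf := norm_nonneg F
    have i1 : (0 : ℝ) ≤ (√P.weight₁)⁻¹ := by positivity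
    have i2 : (0 : ℝ) ≤ (√P.weight₂)⁻¹ := by positivity
    refine max_le ?_ (max_le ?_ ?_)
    · refine (pi_norm_le_iff_of_nonneg (by positivity)).2 fun k => ?_
      have hk := Finset.single_le_sum (fun k _ => hk0 F k) (Finset.mem_univ k)
      have h1 := aux _ _ _ (P.weight_pos k) (norm_nonneg (F.fn k)) hf
        (by linarith [h10 F, h20 F])
      have h2 : (√(P.weight k))⁻¹ ≤ ∑ k, (√(P.weight k))⁻¹ :=
        Finset.single_le_sum (f := fun k => (√(P.weight k))⁻¹)
          (fun k _ => by positivity) (Finset.mem_univ k)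
      exact h1.trans (mul_le_mul_of_nonneg_right (by simp only [C]; linarith) hf)
    · have h1 := aux _ _ _ P.weight₁_pos (norm_nonneg F.c₁) hf (by linarith [h20 F])
      exact h1.trans (mul_le_mul_of_nonneg_right (by simp only [C]; linarith) hf)
    · have h1 := aux _ _ _ P.weight₂_pos (norm_nonneg F.c₂) hf (by linarith [h10 F])
      exact h1.trans (mul_le_mul_of_nonneg_right (by simp only [C]; linarith) hf)
  let D : ℝ := (∑ k, P.weight k) + P.weight₁ + P.weight₂
  have hD : 0 < D := by
    have := Finset.sum_nonneg fun k (_ : k ∈ Finset.univ) => (P.weight_pos k).le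
    have h1 := P.weight₁_pos
    have h2 := P.weight₂_pos
    simp only [D]
    linarith
  have b2 : ∀ G, ‖e.symm G‖ ≤ √D * ‖G‖ := by
    intro G
    refine le_of_sq_le_sq ?_ (by positivity)
    have hn := P.norm_sq_eq (e.symm G)
    have a0 : ∀ k, ‖(e.symm G).fn k‖ ≤ ‖G‖ := fun k => (norm_le_pi_norm G.1 k).trans (norm_fst_le G)
    have a1 : ‖(e.symm G).c₁‖ ≤ ‖G‖ := (norm_fst_le G.2).trans (norm_snd_le G)
    have a2 : ‖(e.symm G).c₂‖ ≤ ‖G‖ := (norm_snd_le G.2).trans (norm_snd_le G)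
    rw [hn, mul_pow, Real.sq_sqrt hD.le]
    have h0 : ∑ k, P.weight k * ‖(e.symm G).fn k‖ ^ 2 ≤ ∑ k, P.weight k * ‖G‖ ^ 2 :=
      Finset.sum_le_sum fun k _ => mul_le_mul_of_nonneg_left
        (pow_le_pow_left₀ (norm_nonneg _) (a0 k) 2) (P.weight_pos k).le
    have h1 := mul_le_mul_of_nonneg_left (pow_le_pow_left₀ (norm_nonneg _) a1 2) P.weight₁_pos.le
    have h2 := mul_le_mul_of_nonneg_left (pow_le_pow_left₀ (norm_nonneg _) a2 2) P.weight₂_pos.le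
    rw [← Finset.sum_mul] at h0
    simp only [D, add_mul]
    linarith
  let E := e.toContinuousLinearEquivOfBounds C (√D) b1 b2
  exact (completeSpace_congr (e := E.toEquiv) E.isUniformEmbedding).2 inferInstance

/-! ### The operator -/

/-- `f` is locally absolutely continuous on each of the open intervals. -/
def IsACLoc (f : ℝ → ℂ) : Prop :=
  ∀ k, ∀ c ∈ P.interval k, ∀ d ∈ P.interval k, AbsolutelyContinuousOnInterval f c d

/-- `f` is the function component of an element of the domain of the operator: `f` and `f'` are
locally absolutely continuous and have finite one-sided limits at the end points of the intervals,
`-ρ f'' + q f` is square integrable, and `f` satisfies the transmission conditions. -/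
structure IsDomainFunction (f : ℝ → ℂ) : Prop where
  differentiableOn : ∀ k, DifferentiableOn ℝ f (P.interval k)
  ac : P.IsACLoc f
  ac_deriv : P.IsACLoc (deriv f)
  hasLimits : P.HasLimits f
  memLp_ell : ∀ k, MemLp (P.ell k f) 2 (volume.restrict (P.interval k))
  transmission₁ : ∀ i, P.trans₁ i f = 0
  transmission₂ : ∀ i, P.trans₂ i f = 0

/-- `F` is the element `(f, B'_a[f], -B'_b[f])` of `P.H`. -/
structure IsAugmented (f : ℝ → ℂ) (F : P.H) : Prop where
  fn_ae_eq : ∀ k, F.fn k =ᵐ[volume.restrict (P.interval k)] f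
  c₁_eq : F.c₁ = P.Ba' f
  c₂_eq : F.c₂ = -P.Bb' f

/-- `G` is the element `(-ρ f'' + q f, B_a[f], B_b[f])` of `P.H`. -/
structure IsImage (f : ℝ → ℂ) (G : P.H) : Prop where
  fn_ae_eq : ∀ k, G.fn k =ᵐ[volume.restrict (P.interval k)] P.ell k f
  c₁_eq : G.c₁ = P.Ba f
  c₂_eq : G.c₂ = P.Bb f

section Linearity

variable {P} {f g : ℝ → ℂ}

theorem isOpen_interval (k : Fin (n + 1)) : IsOpen (P.interval k) := isOpen_Ioo

theorem left_lt_right (k : Fin (n + 1)) : P.ξ k.castSucc < P.ξ k.succ :=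
  P.ξ_strictMono Fin.castSucc_lt_succ

theorem interval_mem_right (k : Fin (n + 1)) : P.interval k ∈ 𝓝[>] (P.ξ k.castSucc) :=
  Ioo_mem_nhdsGT (left_lt_right k)

theorem interval_mem_left (k : Fin (n + 1)) : P.interval k ∈ 𝓝[<] (P.ξ k.succ) :=
  Ioo_mem_nhdsLT (left_lt_right k)

theorem uIcc_subset_interval {k : Fin (n + 1)} {c d : ℝ} (hc : c ∈ P.interval k)
    (hd : d ∈ P.interval k) : uIcc c d ⊆ P.interval k :=
  ordConnected_Ioo.uIcc_subset hc hd

theorem ac_congr {c d : ℝ} (h : EqOn f g (uIcc c d)) (hf : AbsolutelyContinuousOnInterval f c d) :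
    AbsolutelyContinuousOnInterval g c d := by
  rw [absolutelyContinuousOnInterval_iff] at hf ⊢
  intro ε hε
  obtain ⟨δ, hδ, H⟩ := hf ε hε
  refine ⟨δ, hδ, fun E hE hl => ?_⟩
  refine lt_of_eq_of_lt (Finset.sum_congr rfl fun i hi => ?_) (H E hE hl)
  have := hE.1 i hi
  rw [h this.1, h this.2]

theorem IsDomainFunction.deriv_combine (hf : P.IsDomainFunction f) (hg : P.IsDomainFunction g)
    (c : ℂ) (k : Fin (n + 1)) : EqOn (deriv (fun x => f x + c * g x))
      (fun x => deriv f x + c * deriv g x) (P.interval k) := by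
  intro x hx
  have h1 := (hf.differentiableOn k).differentiableAt ((isOpen_interval k).mem_nhds hx)
  have h2 := (hg.differentiableOn k).differentiableAt ((isOpen_interval k).mem_nhds hx)
  exact (h1.hasDerivAt.add (h2.hasDerivAt.const_mul c)).deriv

/-- The derivative of a domain function is differentiable almost everywhere. -/
theorem IsDomainFunction.ae_differentiableAt (hf : P.IsDomainFunction f) (k : Fin (n + 1)) :
    ∀ᵐ x ∂volume.restrict (P.interval k), DifferentiableAt ℝ (deriv f) x := by
  have hb : LocallyBoundedVariationOn (deriv f) (P.interval k) := by
    intro c d hc hd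
    have h := (hf.ac_deriv k c hc d hd).boundedVariationOn
    exact h.mono (inter_subset_right.trans Icc_subset_uIcc)
  filter_upwards [hb.ae_differentiableWithinAt (isOpen_interval k).measurableSet,
    ae_restrict_mem (isOpen_interval k).measurableSet] with x hx hxk
  exact hx.differentiableAt ((isOpen_interval k).mem_nhds hxk)

theorem IsDomainFunction.ell_combine (hf : P.IsDomainFunction f) (hg : P.IsDomainFunction g)
    (c : ℂ) (k : Fin (n + 1)) :
    P.ell k (fun x => f x + c * g x) =ᵐ[volume.restrict (P.interval k)]
      P.ell k f + c • P.ell k g := by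
  filter_upwards [hf.ae_differentiableAt k, hg.ae_differentiableAt k,
    ae_restrict_mem (isOpen_interval k).measurableSet] with x h1 h2 hx
  have h : deriv (fun x => f x + c * g x) =ᶠ[𝓝 x] fun x => deriv f x + c * deriv g x :=
    (hf.deriv_combine hg c k).eventuallyEq_of_mem ((isOpen_interval k).mem_nhds hx)
  have h' : deriv (fun x => deriv f x + c * deriv g x) x =
      deriv (deriv f) x + c * deriv (deriv g) x :=
    (h1.hasDerivAt.add (h2.hasDerivAt.const_mul c)).deriv
  simp only [ell, h.deriv_eq, h', Pi.add_apply, Pi.smul_apply, smul_eq_mul]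
  ring

theorem HasLimits.tendsto_rightLim (h : P.HasLimits f) (k : Fin (n + 1)) :
    Tendsto f (𝓝[>] (P.ξ k.castSucc)) (𝓝 (Function.rightLim f (P.ξ k.castSucc))) :=
  tendsto_rightLim_of_tendsto (h.right k)

theorem HasLimits.tendsto_leftLim (h : P.HasLimits f) (k : Fin (n + 1)) :
    Tendsto f (𝓝[<] (P.ξ k.succ)) (𝓝 (Function.leftLim f (P.ξ k.succ))) :=
  tendsto_leftLim_of_tendsto (h.left k)

theorem HasLimits.tendsto_deriv_rightLim (h : P.HasLimits f) (k : Fin (n + 1)) :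
    Tendsto (deriv f) (𝓝[>] (P.ξ k.castSucc))
      (𝓝 (Function.rightLim (deriv f) (P.ξ k.castSucc))) :=
  tendsto_rightLim_of_tendsto (h.deriv_right k)

theorem HasLimits.tendsto_deriv_leftLim (h : P.HasLimits f) (k : Fin (n + 1)) :
    Tendsto (deriv f) (𝓝[<] (P.ξ k.succ)) (𝓝 (Function.leftLim (deriv f) (P.ξ k.succ))) :=
  tendsto_leftLim_of_tendsto (h.deriv_left k)

/-- One-sided limits of a linear combination. -/
structure LimCombine (P : BVTProblem n) (f g h : ℝ → ℂ) (c : ℂ) : Prop where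
  hasLimits : P.HasLimits h
  rightLim : ∀ k : Fin (n + 1), Function.rightLim h (P.ξ k.castSucc) =
    Function.rightLim f (P.ξ k.castSucc) + c * Function.rightLim g (P.ξ k.castSucc)
  leftLim : ∀ k : Fin (n + 1), Function.leftLim h (P.ξ k.succ) =
    Function.leftLim f (P.ξ k.succ) + c * Function.leftLim g (P.ξ k.succ)
  deriv_rightLim : ∀ k : Fin (n + 1), Function.rightLim (deriv h) (P.ξ k.castSucc) =
    Function.rightLim (deriv f) (P.ξ k.castSucc) +
      c * Function.rightLim (deriv g) (P.ξ k.castSucc)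
  deriv_leftLim : ∀ k : Fin (n + 1), Function.leftLim (deriv h) (P.ξ k.succ) =
    Function.leftLim (deriv f) (P.ξ k.succ) + c * Function.leftLim (deriv g) (P.ξ k.succ)

theorem limCombine {h : ℝ → ℂ} {c : ℂ} (hf : P.HasLimits f) (hg : P.HasLimits g)
    (e : ∀ k, EqOn h (fun x => f x + c * g x) (P.interval k))
    (e' : ∀ k, EqOn (deriv h) (fun x => deriv f x + c * deriv g x) (P.interval k)) :
    P.LimCombine f g h c := by
  have r := fun k => ((hf.tendsto_rightLim k).add ((hg.tendsto_rightLim k).const_mul c)).congr'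
    ((e k).symm.eventuallyEq_of_mem (interval_mem_right k))
  have l := fun k => ((hf.tendsto_leftLim k).add ((hg.tendsto_leftLim k).const_mul c)).congr'
    ((e k).symm.eventuallyEq_of_mem (interval_mem_left k))
  have r' := fun k => ((hf.tendsto_deriv_rightLim k).add
    ((hg.tendsto_deriv_rightLim k).const_mul c)).congr'
    ((e' k).symm.eventuallyEq_of_mem (interval_mem_right k))
  have l' := fun k => ((hf.tendsto_deriv_leftLim k).add
    ((hg.tendsto_deriv_leftLim k).const_mul c)).congr'
    ((e' k).symm.eventuallyEq_of_mem (interval_mem_left k))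
  exact ⟨⟨fun k => ⟨_, r k⟩, fun k => ⟨_, l k⟩, fun k => ⟨_, r' k⟩, fun k => ⟨_, l' k⟩⟩,
    fun k => rightLim_eq_of_tendsto (r k), fun k => leftLim_eq_of_tendsto (l k),
    fun k => rightLim_eq_of_tendsto (r' k), fun k => leftLim_eq_of_tendsto (l' k)⟩

namespace LimCombine

variable {h : ℝ → ℂ} {c : ℂ}

theorem Ba_eq (L : P.LimCombine f g h c) : P.Ba h = P.Ba f + c * P.Ba g := by
  have h1 := L.rightLim 0
  have h2 := L.deriv_rightLim 0
  rw [Fin.castSucc_zero] at h1 h2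
  simp only [Ba, a, h1, h2]
  ring

theorem Ba'_eq (L : P.LimCombine f g h c) : P.Ba' h = P.Ba' f + c * P.Ba' g := by
  have h1 := L.rightLim 0
  have h2 := L.deriv_rightLim 0
  rw [Fin.castSucc_zero] at h1 h2
  simp only [Ba', a, h1, h2]
  ring

theorem Bb_eq (L : P.LimCombine f g h c) : P.Bb h = P.Bb f + c * P.Bb g := by
  have h1 := L.leftLim (Fin.last n)
  have h2 := L.deriv_leftLim (Fin.last n)
  rw [Fin.succ_last] at h1 h2
  simp only [Bb, b, h1, h2]
  ring

theorem Bb'_eq (L : P.LimCombine f g h c) : P.Bb' h = P.Bb' f + c * P.Bb' g := by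
  have h1 := L.leftLim (Fin.last n)
  have h2 := L.deriv_leftLim (Fin.last n)
  rw [Fin.succ_last] at h1 h2
  simp only [Bb', b, h1, h2]
  ring

theorem trans₁_eq (L : P.LimCombine f g h c) (i : Fin n) :
    P.trans₁ i h = P.trans₁ i f + c * P.trans₁ i g := by
  have h1 := L.rightLim i.succ
  have h2 := L.deriv_rightLim i.succ
  have h3 := L.leftLim i.castSucc
  have h4 := L.deriv_leftLim i.castSucc
  rw [Fin.succ_castSucc] at h3 h4
  simp only [trans₁, node, h1, h2, h3, h4]
  ring

theorem trans₂_eq (L : P.LimCombine f g h c) (i : Fin n) :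
    P.trans₂ i h = P.trans₂ i f + c * P.trans₂ i g := by
  have h1 := L.rightLim i.succ
  have h2 := L.deriv_rightLim i.succ
  have h3 := L.leftLim i.castSucc
  have h4 := L.deriv_leftLim i.castSucc
  rw [Fin.succ_castSucc] at h3 h4
  simp only [trans₂, node, h1, h2, h3, h4]
  ring

end LimCombine

theorem IsDomainFunction.limCombine (hf : P.IsDomainFunction f) (hg : P.IsDomainFunction g)
    (c : ℂ) : P.LimCombine f g (fun x => f x + c * g x) c :=
  BVTProblem.limCombine hf.hasLimits hg.hasLimits (fun _ _ _ => rfl) (hf.deriv_combine hg c)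

theorem IsDomainFunction.combine (hf : P.IsDomainFunction f) (hg : P.IsDomainFunction g)
    (c : ℂ) : P.IsDomainFunction (fun x => f x + c * g x) where
  differentiableOn k := (hf.differentiableOn k).add ((hg.differentiableOn k).const_mul c)
  ac k x hx y hy := (hf.ac k x hx y hy).add ((hg.ac k x hx y hy).const_smul c)
  ac_deriv k x hx y hy :=
    ac_congr ((hf.deriv_combine hg c k).symm.mono (uIcc_subset_interval hx hy))
      ((hf.ac_deriv k x hx y hy).add ((hg.ac_deriv k x hx y hy).const_smul c))
  hasLimits := (hf.limCombine hg c).hasLimits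
  memLp_ell k := ((hf.memLp_ell k).add ((hg.memLp_ell k).const_smul c)).ae_eq
    (hf.ell_combine hg c k).symm
  transmission₁ i := by
    rw [(hf.limCombine hg c).trans₁_eq, hf.transmission₁, hg.transmission₁, mul_zero, add_zero]
  transmission₂ i := by
    rw [(hf.limCombine hg c).trans₂_eq, hf.transmission₂, hg.transmission₂, mul_zero, add_zero]

theorem IsAugmented.combine {F G : P.H} (hf : P.IsDomainFunction f) (hg : P.IsDomainFunction g)
    (hF : P.IsAugmented f F) (hG : P.IsAugmented g G) (c : ℂ) :
    P.IsAugmented (fun x => f x + c * g x) (F + c • G) where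
  fn_ae_eq k := by
    rw [H.fn_add, H.fn_smul]
    filter_upwards [Lp.coeFn_add (F.fn k) (c • G.fn k), Lp.coeFn_smul c (G.fn k),
      hF.fn_ae_eq k, hG.fn_ae_eq k] with x h1 h2 h3 h4
    rw [h1, Pi.add_apply, h2, Pi.smul_apply, h3, h4, smul_eq_mul]
  c₁_eq := by
    rw [(hf.limCombine hg c).Ba'_eq, H.c₁_add, H.c₁_smul, hF.c₁_eq, hG.c₁_eq]
  c₂_eq := by
    rw [(hf.limCombine hg c).Bb'_eq, H.c₂_add, H.c₂_smul, hF.c₂_eq, hG.c₂_eq]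
    ring

theorem IsImage.combine {F G : P.H} (hf : P.IsDomainFunction f) (hg : P.IsDomainFunction g)
    (hF : P.IsImage f F) (hG : P.IsImage g G) (c : ℂ) :
    P.IsImage (fun x => f x + c * g x) (F + c • G) where
  fn_ae_eq k := by
    rw [H.fn_add, H.fn_smul]
    filter_upwards [Lp.coeFn_add (F.fn k) (c • G.fn k), Lp.coeFn_smul c (G.fn k),
      hF.fn_ae_eq k, hG.fn_ae_eq k, hf.ell_combine hg c k] with x h1 h2 h3 h4 h5
    rw [h1, Pi.add_apply, h2, Pi.smul_apply, h3, h4, h5, Pi.add_apply, Pi.smul_apply]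
  c₁_eq := by
    rw [(hf.limCombine hg c).Ba_eq, H.c₁_add, H.c₁_smul, hF.c₁_eq, hG.c₁_eq]
  c₂_eq := by
    rw [(hf.limCombine hg c).Bb_eq, H.c₂_add, H.c₂_smul, hF.c₂_eq, hG.c₂_eq]

theorem vanish (hf : ∀ k, EqOn f 0 (P.interval k)) :
    (∀ k, EqOn (P.ell k f) 0 (P.interval k)) ∧ P.HasLimits f ∧ P.Ba f = 0 ∧ P.Ba' f = 0 ∧
      P.Bb f = 0 ∧ P.Bb' f = 0 ∧ (∀ i, P.trans₁ i f = 0) ∧ ∀ i, P.trans₂ i f = 0 := by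
  have hz : P.HasLimits (0 : ℝ → ℂ) := by
    have h0 : deriv (0 : ℝ → ℂ) = 0 := deriv_zero
    constructor <;> intro k <;> refine ⟨0, ?_⟩ <;> (try rw [h0]) <;> exact tendsto_const_nhds
  have hd : ∀ k, EqOn (deriv f) 0 (P.interval k) := fun k x hx => by
    have h : f =ᶠ[𝓝 x] 0 := (hf k).eventuallyEq_of_mem ((isOpen_interval k).mem_nhds hx)
    rw [h.deriv_eq]
    simp
  have hdd : ∀ k, EqOn (deriv (deriv f)) 0 (P.interval k) := fun k x hx => by
    have h : deriv f =ᶠ[𝓝 x] 0 := (hd k).eventuallyEq_of_mem ((isOpen_interval k).mem_nhds hx)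
    rw [h.deriv_eq]
    simp
  have L : P.LimCombine 0 0 f (-1) := BVTProblem.limCombine hz hz
    (fun k x hx => by simp [hf k hx]) (fun k x hx => by simp [hd k hx])
  refine ⟨fun k x hx => ?_, L.hasLimits, ?_, ?_, ?_, ?_, fun i => ?_, fun i => ?_⟩
  · simp [ell, hf k hx, hdd k hx]
  · rw [L.Ba_eq]; ring
  · rw [L.Ba'_eq]; ring
  · rw [L.Bb_eq]; ring
  · rw [L.Bb'_eq]; ring
  · rw [L.trans₁_eq]; ring
  · rw [L.trans₂_eq]; ring

theorem isDomainFunction_zero : P.IsDomainFunction (0 : ℝ → ℂ) := by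
  obtain ⟨h1, h2, -, -, -, -, h3, h4⟩ := vanish (P := P) (f := 0) fun _ _ _ => rfl
  have hac : P.IsACLoc 0 := fun k c _ d _ =>
    ((LipschitzWith.const (0 : ℂ)).lipschitzOnWith (s := uIcc c d)).absolutelyContinuousOnInterval
  refine ⟨fun k => differentiableOn_const 0, hac, ?_, h2, fun k => ?_, h3, h4⟩
  · rwa [show deriv (0 : ℝ → ℂ) = 0 from deriv_zero]
  · refine MemLp.zero.ae_eq (f := 0) ?_
    filter_upwards [ae_restrict_mem (isOpen_interval k).measurableSet] with x hx
    exact (h1 k hx).symm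

theorem IsAugmented.isAugmented_zero : P.IsAugmented (0 : ℝ → ℂ) (0 : P.H) := by
  obtain ⟨-, -, -, h1, -, h2, -, -⟩ := vanish (P := P) (f := 0) fun _ _ _ => rfl
  exact ⟨fun k => Lp.coeFn_zero _ _ _, by rw [h1]; rfl, by rw [h2, neg_zero]; rfl⟩

theorem IsImage.isImage_zero : P.IsImage (0 : ℝ → ℂ) (0 : P.H) := by
  obtain ⟨h0, -, h1, -, h2, -, -, -⟩ := vanish (P := P) (f := 0) fun _ _ _ => rfl
  refine ⟨fun k => ?_, by rw [h1]; rfl, by rw [h2]; rfl⟩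
  filter_upwards [Lp.coeFn_zero ℂ 2 (volume.restrict (P.interval k)),
    ae_restrict_mem (isOpen_interval k).measurableSet] with x hx hxk
  rw [H.fn_zero, hx, h0 k hxk]

end Linearity

/-- The graph of the operator: all pairs of `(f, B'_a[f], -B'_b[f])` and
`(-ρ f'' + q f, B_a[f], B_b[f])`, where `f` runs over the domain functions. -/
noncomputable def graphR : Submodule ℂ (P.H × P.H) where
  carrier := {p | ∃ f, P.IsDomainFunction f ∧ P.IsAugmented f p.1 ∧ P.IsImage f p.2}
  zero_mem' := ⟨0, isDomainFunction_zero, IsAugmented.isAugmented_zero, IsImage.isImage_zero⟩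
  add_mem' := by
    rintro ⟨F, F'⟩ ⟨G, G'⟩ ⟨f, hf, hF, hF'⟩ ⟨g, hg, hG, hG'⟩
    refine ⟨_, hf.combine hg 1, ?_, ?_⟩
    · simpa using hF.combine hf hg hG 1
    · simpa using hF'.combine hf hg hG' 1
  smul_mem' := by
    rintro c ⟨G, G'⟩ ⟨g, hg, hG, hG'⟩
    refine ⟨_, isDomainFunction_zero.combine hg c, ?_, ?_⟩
    · simpa using IsAugmented.isAugmented_zero.combine isDomainFunction_zero hg hG c
    · simpa using IsImage.isImage_zero.combine isDomainFunction_zero hg hG' c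

/-- The relation `graphR` is single-valued, i.e. it is the graph of an operator. -/
theorem graphR_functional (p : P.H × P.H) (hp : p ∈ P.graphR) (h0 : p.1 = 0) : p.2 = 0 := by
  obtain ⟨f, hf, hF, hG⟩ := hp
  have hz : ∀ k, EqOn f 0 (P.interval k) := fun k => by
    refine Measure.eqOn_open_of_ae_eq (μ := volume) ?_ (isOpen_interval k)
      (hf.differentiableOn k).continuousOn continuousOn_const
    have h1 := hF.fn_ae_eq k
    rw [h0, H.fn_zero] at h1
    exact h1.symm.trans (Lp.coeFn_zero _ _ _)
  obtain ⟨h1, -, h2, -, h3, -, -, -⟩ := vanish hz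
  refine H.ext (fun k => ?_) (by rw [hG.c₁_eq, h2]; rfl) (by rw [hG.c₂_eq, h3]; rfl)
  refine Lp.ext ?_
  filter_upwards [hG.fn_ae_eq k, Lp.coeFn_zero ℂ 2 (volume.restrict (P.interval k)),
    ae_restrict_mem (isOpen_interval k).measurableSet] with x hx hx0 hxk
  rw [hx, h1 k hxk, H.fn_zero, hx0]

/-- The operator with domain `{(f, B'_a[f], -B'_b[f]) | f a domain function}` and action
`(f, B'_a[f], -B'_b[f]) ↦ (-ρ f'' + q f, B_a[f], B_b[f])`. -/
noncomputable def R : P.H →ₗ.[ℂ] P.H := P.graphR.toLinearPMap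

theorem graph_R : P.R.graph = P.graphR :=
  Submodule.toLinearPMap_graph_eq _ P.graphR_functional

/-- The set of eigenfunctions (nonzero eigenvectors) of the operator. -/
def eigenvectors : Set P.H :=
  {F | F ≠ 0 ∧ ∃ lam : ℂ, ∃ hF : F ∈ P.R.domain, P.R ⟨F, hF⟩ = lam • F}

/-- `S` is a maximal orthonormal set of eigenfunctions of the operator. -/
def IsMaximalOrthonormalEigenset (S : Set P.H) : Prop :=
  Maximal (fun T : Set P.H => T ⊆ P.eigenvectors ∧ Orthonormal ℂ ((↑) : T → P.H)) S

end BVTProblem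

/-! The operator is symmetric and has a compact resolvent, so the spectral theorem for compact
self-adjoint operators gives completeness.

Symmetry: on each interval Lagrange's identity turns the difference of the two inner products into
boundary values of the Wronskian of `f` and `conj g` (`IsDomainFunction.integral_lagrange`). At an
interior point the transmission conditions multiply the Wronskian by a ratio of the minors `θ i 2 3`
and `θ i 0 1` (`transmission_wronskian`), and the weights of adjacent intervals have the inverse
ratio, so the sum telescopes. What survives at `a` and `b` is cancelled by the two scalar
components.

Real non-eigenvalue: eigenvectors for distinct real eigenvalues are orthogonal and the space is
separable, so some real `μ` is not an eigenvalue (`exists_not_eigenvalue`).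

Compact resolvent: a function is encoded by its second derivative on each interval together with its
value and derivative at the left end points. In these data, the problem `(R - μ) F = G` reads `x - T
x = rhs`. The operator `T` is compact, because recovering the function from its second derivative
involves Volterra operators and all the conditions are scalar. A fixed point of `T` yields an
eigenvector for `μ`, hence is zero, and the Fredholm alternative solves the equation for every `G`
(`exists_compact_resolvent`). The resolvent `K` is then symmetric, and `c ↦ (c - μ)⁻¹` matches the
eigenvalues of the operator with those of `K`, the eigenvectors being the same. No eigenvalue of `K`
is lost, since single-valuedness of the graph makes `K` injective.

Eigenvectors versus eigenfunctions: an eigenvector satisfies the differential equation only almost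
everywhere, but then `f'` is a primitive of a continuous function, so the equation holds at every
point. -/

/-! ### Symmetric relations and compact self-adjoint operators -/

section SymmetricRelation

variable {E : Type*} [NormedAddCommGroup E] [InnerProductSpace ℂ E]

/-- A linear relation `Γ` is symmetric. -/
def Submodule.IsSymmetricRel (Γ : Submodule ℂ (E × E)) : Prop :=
  ∀ p ∈ Γ, ∀ q ∈ Γ, inner ℂ p.2 q.1 = inner ℂ p.1 q.2

/-- The nonzero eigenvectors of a linear relation. -/
def Submodule.relEigenvectors (Γ : Submodule ℂ (E × E)) : Set E :=
  {x | x ≠ 0 ∧ ∃ c : ℂ, (x, c • x) ∈ Γ}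

/-- Distinct members are at distance `√2`, so `S` is a discrete subset of a second countable space.
-/
theorem Orthonormal.countable_of_separable [TopologicalSpace.SeparableSpace E] {S : Set E}
    (hS : Orthonormal ℂ ((↑) : S → E)) : S.Countable := by
  have : DiscreteTopology S := by
    refine DiscreteTopology.of_forall_le_dist (r := 1) one_pos fun x y hxy => ?_
    have h1 := norm_sub_sq (𝕜 := ℂ) (x : E) (y : E)
    rw [hS.1 x, hS.1 y, hS.2 hxy] at h1
    change 1 ≤ dist (x : E) (y : E)
    rw [dist_eq_norm]
    simp only [map_zero] at h1
    nlinarith [norm_nonneg ((x : E) - y)]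
  have : SecondCountableTopology E := UniformSpace.secondCountable_of_separable E
  exact TopologicalSpace.separableSpace_iff_countable.1 (inferInstanceAs (TopologicalSpace.SeparableSpace S))

theorem orthonormal_subtype_insert {S : Set E} (hS : Orthonormal ℂ ((↑) : S → E)) {e : E}
    (he : ‖e‖ = 1) (h : ∀ s ∈ S, inner ℂ s e = 0) :
    Orthonormal ℂ ((↑) : ↥(insert e S) → E) := by
  refine ⟨?_, ?_⟩
  · rintro ⟨x, rfl | hx⟩
    · exact he
    · exact hS.1 ⟨x, hx⟩
  · rintro ⟨x, hx⟩ ⟨y, hy⟩ hxy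
    rcases hx with rfl | hx <;> rcases hy with rfl | hy
    · exact absurd rfl hxy
    · exact inner_eq_zero_symm.1 (h y hy)
    · exact h x hx
    · exact hS.2 (i := ⟨x, hx⟩) (j := ⟨y, hy⟩) fun h => hxy (Subtype.ext (by simpa using h))

/-- A maximal orthonormal set of eigenvectors of a compact self-adjoint operator is total. -/
theorem IsCompactOperator.span_maximal_eigenset_dense [CompleteSpace E] {K : E →L[ℂ] E}
    (hK : IsCompactOperator K) (hsymm : (K : E →ₗ[ℂ] E).IsSymmetric) {S : Set E}
    (hS : Maximal (fun T : Set E => T ⊆ {x | x ≠ 0 ∧ ∃ c : ℂ, K x = c • x} ∧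
      Orthonormal ℂ ((↑) : T → E)) S) :
    (Submodule.span ℂ S).topologicalClosure = ⊤ := by
  set N : Submodule ℂ E := (Submodule.span ℂ S)ᗮ with hN
  have hN_iff : ∀ v, v ∈ N ↔ ∀ s ∈ S, inner ℂ s v = 0 := fun v =>
    ⟨fun hv s hs => hv s (Submodule.subset_span hs), fun hv => by
      rw [hN, Submodule.mem_orthogonal]
      intro u hu
      induction hu using Submodule.span_induction with
      | mem x h => exact hv x h
      | zero => simp
      | add x y _ _ hx hy => rw [inner_add_left, hx, hy, add_zero]
      | smul c x _ hx => rw [inner_smul_left, hx, mul_zero]⟩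
  have hKN : ∀ v ∈ N, K v ∈ N := fun v hv => (hN_iff _).2 fun s hs => by
    obtain ⟨-, c, hc⟩ := hS.1.1 hs
    have := hsymm s v
    simp only [ContinuousLinearMap.coe_coe] at this
    rw [← this, hc, inner_smul_left, (hN_iff v).1 hv s hs, mul_zero]
  have hKN' : ∀ w ∈ Nᗮ, K w ∈ Nᗮ := fun w hw v hv => by
    have := hsymm v w
    simp only [ContinuousLinearMap.coe_coe] at this
    rw [← this]
    exact hw _ (hKN v hv)
  -- Both `N` and its complement are invariant under `K`, so the `N`-component `v` of an eigenvector
  -- is itself an eigenvector or zero. If nonzero, it could be normalized and added to `S`, against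
  -- maximality.
  have hE : ∀ c : ℂ, Module.End.eigenspace (K : Module.End ℂ E) c ≤ Nᗮ := by
    intro c x hx
    rw [Module.End.mem_eigenspace_iff] at hx
    have hx : K x = c • x := hx
    have : CompleteSpace N := (Submodule.isClosed_orthogonal _).completeSpace_coe
    obtain ⟨v, hv, w, hw, rfl⟩ := N.exists_add_mem_mem_orthogonal x
    have h1 : K v - c • v = -(K w - c • w) := by
      rw [map_add, smul_add] at hx
      linear_combination (norm := module) hx
    have h2 : K v - c • v = 0 := by
      have h3 : K v - c • v ∈ N := N.sub_mem (hKN v hv) (N.smul_mem c hv)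
      have h4 : K v - c • v ∈ Nᗮ := by
        rw [h1]
        exact Nᗮ.neg_mem (Nᗮ.sub_mem (hKN' w hw) (Nᗮ.smul_mem c hw))
      exact inner_self_eq_zero.1 (h4 _ h3)
    by_cases hv0 : v = 0
    · rw [hv0, zero_add]
      exact hw
    exfalso
    set e : E := ((‖v‖ : ℂ)⁻¹) • v with he
    have hn : ‖e‖ = 1 := norm_smul_inv_norm hv0
    have heS : ∀ s ∈ S, inner ℂ s e = 0 := fun s hs => by
      rw [he, inner_smul_right, (hN_iff v).1 hv s hs, mul_zero]
    have hmem : e ∈ S := by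
      refine hS.2 (y := insert e S) ⟨insert_subset ⟨?_, c, ?_⟩ hS.1.1,
        orthonormal_subtype_insert hS.1.2 hn heS⟩ (subset_insert e S) (mem_insert e S)
      · intro h0
        rw [h0, norm_zero] at hn
        exact zero_ne_one hn
      · rw [he, map_smul, sub_eq_zero.1 h2, smul_comm]
    have h5 := heS e hmem
    rw [inner_self_eq_zero.1 h5, norm_zero] at hn
    exact zero_ne_one hn
  -- The spectral theorem: the eigenspaces of `K` span a dense subspace, and all of them lie in the
  -- complement of `N`.
  have hbot : N = ⊥ := by
    have h1 : (⨆ c, Module.End.eigenspace (K : Module.End ℂ E) c) ≤ Nᗮ := iSup_le hE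
    have h2 := Submodule.orthogonal_le h1
    have h3 := ContinuousLinearMap.orthogonalComplement_iSup_eigenspaces_eq_bot hK hsymm
    rw [h3] at h2
    exact le_bot_iff.1 ((Submodule.le_orthogonal_orthogonal N).trans h2)
  rwa [Submodule.topologicalClosure_eq_top_iff]

namespace Submodule.IsSymmetricRel

variable {Γ : Submodule ℂ (E × E)}

theorem inner_eq_zero (hΓ : Γ.IsSymmetricRel) {x y : E} {c d : ℝ} (hx : (x, (c : ℂ) • x) ∈ Γ) (hy : (y, (d : ℂ) • y) ∈ Γ)
    (hcd : c ≠ d) : inner ℂ x y = 0 := by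
  have h := hΓ _ hx _ hy
  simp only [inner_smul_left, inner_smul_right, Complex.conj_ofReal] at h
  rw [← sub_eq_zero, ← sub_mul] at h
  refine (mul_eq_zero.1 h).resolve_left ?_
  rw [← Complex.ofReal_sub]
  exact_mod_cast sub_ne_zero.2 hcd

/-- In a separable space, some real number is not an eigenvalue of a symmetric relation. -/
theorem exists_not_eigenvalue [TopologicalSpace.SeparableSpace E] (hΓ : Γ.IsSymmetricRel) :
    ∃ c : ℝ, ∀ x, (x, (c : ℂ) • x) ∈ Γ → x = 0 := by
  by_contra! hcon
  choose x hx hx0 using hcon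
  -- If every real number were an eigenvalue, normalized eigenvectors would form an orthonormal
  -- family indexed by `ℝ`.
  let e : ℝ → E := fun c => ((‖x c‖ : ℂ)⁻¹) • x c
  have hn : ∀ c, ‖e c‖ = 1 := fun c => norm_smul_inv_norm (hx0 c)
  have ho : Orthonormal ℂ e := ⟨hn, fun c d hcd => by
    simp only [e, inner_smul_left, inner_smul_right, hΓ.inner_eq_zero (hx c) (hx d) hcd, mul_zero]⟩
  have hc := ho.toSubtypeRange.countable_of_separable
  have : (univ : Set ℝ).Countable := by
    rw [← image_univ] at hc
    exact countable_of_injective_of_countable_image (ho.linearIndependent.injective.injOn) hc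
  exact not_countable_univ this

end Submodule.IsSymmetricRel

/-- Every set of vectors has a maximal orthonormal subset. -/
theorem exists_maximal_orthonormal_subset (A : Set E) :
    ∃ S : Set E, Maximal (fun T : Set E => T ⊆ A ∧ Orthonormal ℂ ((↑) : T → E)) S := by
  refine zorn_subset _ fun c hc hchain => ⟨⋃₀ c, ⟨sUnion_subset fun s hs => (hc hs).1, ?_⟩,
    fun s hs => subset_sUnion_of_mem hs⟩
  exact orthonormal_sUnion_of_directed hchain.directedOn fun s hs => (hc hs).2

/-- The eigenvectors of a symmetric operator with compact resolvent are complete. -/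
theorem Submodule.IsSymmetricRel.span_maximal_eigenset_dense [CompleteSpace E]
    {Γ : Submodule ℂ (E × E)} (hΓ : Γ.IsSymmetricRel) (hfun : ∀ p ∈ Γ, p.1 = 0 → p.2 = 0)
    {μ : ℝ} (hμ : ∀ x, (x, (μ : ℂ) • x) ∈ Γ → x = 0) {K : E →L[ℂ] E} (hK : IsCompactOperator K)
    (hKΓ : ∀ y, (K y, (μ : ℂ) • K y + y) ∈ Γ) {S : Set E}
    (hS : Maximal (fun T : Set E => T ⊆ Γ.relEigenvectors ∧ Orthonormal ℂ ((↑) : T → E)) S) :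
    (Submodule.span ℂ S).topologicalClosure = ⊤ := by
  -- Symmetry of `Γ` applied to two resolvent pairs; since `μ` is real, the `μ`-terms cancel.
  have hsymm : (K : E →ₗ[ℂ] E).IsSymmetric := fun x y => by
    have h := hΓ _ (hKΓ x) _ (hKΓ y)
    simp only [inner_add_left, inner_add_right, inner_smul_left, inner_smul_right,
      Complex.conj_ofReal] at h
    exact (add_left_cancel h).symm
  have heq : Γ.relEigenvectors = {x | x ≠ 0 ∧ ∃ c : ℂ, K x = c • x} := by
    ext x
    refine and_congr_right fun hx => ⟨?_, ?_⟩
    · rintro ⟨c, hc⟩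
      have hcμ : c - μ ≠ 0 := fun h => hx (hμ x (by rwa [sub_eq_zero.1 h] at hc))
      -- Both `K ((c - μ) • x)` and `x` solve `(Γ - μ) z = (c - μ) • x`; their difference is in the
      -- kernel of `Γ - μ`, which is trivial.
      have h1 := Γ.sub_mem (hKΓ ((c - μ) • x)) hc
      have h2 := hμ (K ((c - μ) • x) - x) (by
        convert h1 using 1
        simp only [Prod.mk_sub_mk, Prod.mk.injEq, true_and]
        module)
      refine ⟨(c - μ)⁻¹, ?_⟩
      rw [map_smul, sub_eq_zero] at h2
      rw [← h2, smul_smul, inv_mul_cancel₀ hcμ, one_smul, h2]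
    · rintro ⟨c, hc⟩
      have h1 := hKΓ x
      rw [hc] at h1
      -- If `K x = 0` then `(0, x)` belongs to `Γ`, and single-valuedness forces `x = 0`.
      have hc0 : c ≠ 0 := by
        rintro rfl
        have := hfun _ h1 (zero_smul ℂ x)
        simp only [zero_smul, smul_zero, zero_add] at this
        exact hx this
      refine ⟨μ + c⁻¹, ?_⟩
      have h2 := Γ.smul_mem c⁻¹ h1
      convert h2 using 1
      simp only [Prod.smul_mk, smul_add, smul_smul, inv_mul_cancel₀ hc0, one_smul, Prod.mk.injEq,
        true_and, add_smul]
      rw [mul_left_comm, inv_mul_cancel₀ hc0, mul_one]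
  rw [heq] at hS
  exact hK.span_maximal_eigenset_dense hsymm hS

/-- The span of a finite set is finite-dimensional, hence closed, and would be the whole space. -/
theorem infinite_of_span_dense (hE : ¬ FiniteDimensional ℂ E) {S : Set E}
    (hS : (Submodule.span ℂ S).topologicalClosure = ⊤) : S.Infinite := by
  intro hfin
  have : FiniteDimensional ℂ (Submodule.span ℂ S) := FiniteDimensional.span_of_finite ℂ hfin
  rw [Submodule.topologicalClosure_eq_self] at hS
  rw [hS] at this
  exact hE (Module.finite_def.2 (Module.Finite.iff_fg.1 this))

end SymmetricRelation

/-! ### The Fredholm alternative -/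

/-- For a compact operator `T`, injectivity of `1 - T` yields a bounded right inverse. -/
theorem IsCompactOperator.exists_right_inverse {X : Type*} [NormedAddCommGroup X]
    [NormedSpace ℂ X] [CompleteSpace X] {T : X →L[ℂ] X} (hT : IsCompactOperator T)
    (hinj : ∀ x, T x = x → x = 0) : ∃ S : X →L[ℂ] X, ∀ y, S y - T (S y) = y := by
  have h1 : ¬ Module.End.HasEigenvalue (T : Module.End ℂ X) 1 := by
    intro h
    obtain ⟨x, hx⟩ := h.exists_hasEigenvector
    refine hx.2 (hinj x ?_)
    simpa using hx.apply_eq_smul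
  have h2 := (hT.hasEigenvalue_or_mem_resolventSet one_ne_zero).resolve_left h1
  rw [spectrum.mem_resolventSet_iff, map_one] at h2
  obtain ⟨u, hu⟩ := h2
  refine ⟨(↑u⁻¹ : X →L[ℂ] X), fun y => ?_⟩
  have h3 : (u : X →L[ℂ] X) ((↑u⁻¹ : X →L[ℂ] X) y) = y := DFunLike.congr_fun u.mul_inv y
  rw [hu] at h3
  exact h3

/-! ### Vector-valued absolutely continuous functions -/

namespace AbsolutelyContinuousOnInterval

variable {F G : Type*} [NormedAddCommGroup F] [NormedAddCommGroup G]

/-- Absolute continuity only concerns increments, so it passes to any function whose increments are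
dominated. This handles conjugation, and functions that differ from a primitive by a constant. -/
theorem of_dist_le {f : ℝ → F} {g : ℝ → G} {a b : ℝ} (hg : AbsolutelyContinuousOnInterval g a b)
    (h : ∀ x ∈ uIcc a b, ∀ y ∈ uIcc a b, dist (f x) (f y) ≤ dist (g x) (g y)) :
    AbsolutelyContinuousOnInterval f a b := by
  rw [absolutelyContinuousOnInterval_iff] at hg ⊢
  intro ε hε
  obtain ⟨δ, hδ, H⟩ := hg ε hε
  refine ⟨δ, hδ, fun E hE hl => lt_of_le_of_lt (Finset.sum_le_sum fun i hi => ?_) (H E hE hl)⟩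
  exact h _ (hE.1 i hi).1 _ (hE.1 i hi).2

theorem conj_comp {f : ℝ → ℂ} {a b : ℝ} (hf : AbsolutelyContinuousOnInterval f a b) :
    AbsolutelyContinuousOnInterval (fun x => conj (f x)) a b :=
  hf.of_dist_le fun x _ y _ => by rw [Complex.dist_conj_conj]

variable [NormedSpace ℝ F]

/-- The increments are dominated by those of the real-valued primitive of `‖h‖`. -/
theorem of_primitive {h : ℝ → F} {a b c : ℝ} (hh : IntervalIntegrable h volume a b)
    (hc : c ∈ uIcc a b) : AbsolutelyContinuousOnInterval (fun x => ∫ t in c..x, h t) a b := by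
  refine (hh.norm.absolutelyContinuousOnInterval_intervalIntegral hc).of_dist_le
    fun x hx y hy => ?_
  have i : ∀ x ∈ uIcc a b, ∀ y ∈ uIcc a b, IntervalIntegrable h volume x y := fun x hx y hy =>
    hh.mono_set (uIcc_subset_uIcc hx hy)
  rw [dist_eq_norm, dist_eq_norm, intervalIntegral.integral_interval_sub_left (i c hc x hx)
    (i c hc y hy), intervalIntegral.integral_interval_sub_left (i c hc x hx).norm
    (i c hc y hy).norm]
  exact intervalIntegral.norm_integral_le_abs_integral_norm

/-- The fundamental theorem of calculus for absolutely continuous vector-valued functions. -/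
theorem integral_eq_sub [CompleteSpace F] {f f' : ℝ → F} {a b : ℝ}
    (hf : AbsolutelyContinuousOnInterval f a b)
    (hd : ∀ᵐ x, x ∈ uIcc a b → HasDerivAt f (f' x) x) (hi : IntervalIntegrable f' volume a b) :
    ∫ x in a..b, f' x = f b - f a := by
  -- Subtracting the primitive of `f'` leaves an absolutely continuous function with derivative zero
  -- almost everywhere, which is constant.
  have hg := hf.sub (of_primitive hi (left_mem_uIcc : a ∈ uIcc a b))
  obtain ⟨C, hC⟩ := hg.const_of_ae_hasDerivAt_zero (by
    filter_upwards [hd, hi.ae_hasDerivAt_integral] with x h1 h2 hx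
    simpa using! (h1 hx).sub (h2 hx a left_mem_uIcc))
  have h1 := hC a left_mem_uIcc
  have h2 := hC b right_mem_uIcc
  rw [← h1] at h2
  simp only [Pi.sub_apply, intervalIntegral.integral_same, sub_zero] at h2
  rw [← h2]
  abel

end AbsolutelyContinuousOnInterval

/-! ### Compactness of the Volterra operator -/

section Volterra

variable {c d : ℝ}

theorem intervalIntegrable_of_memLp {f : ℝ → ℂ} (hcd : c ≤ d)
    (hf : MemLp f 2 (volume.restrict (Ioo c d))) : IntervalIntegrable f volume c d :=
  (intervalIntegrable_iff_integrableOn_Ioo_of_le hcd).2 (hf.integrable one_le_two)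

/-- The indicator function of `(c, x]` as an element of `L₂(c, d)`. -/
noncomputable def cutIndicator (c d x : ℝ) : Lp ℂ 2 (volume.restrict (Ioo c d)) :=
  indicatorConstLp 2 (measurableSet_Ioc (a := c) (b := x)) (measure_ne_top _ _) 1

/-- The two indicators differ only between `x` and `y`, and the `L₂` norm of an indicator is the
square root of a measure. This modulus makes primitives of `L₂` functions Hölder continuous of order
`1/2`. -/
theorem dist_cutIndicator_le (x y : ℝ) :
    dist (cutIndicator c d x) (cutIndicator c d y) ≤ √(dist x y) := by
  rw [cutIndicator, cutIndicator, dist_indicatorConstLp_eq_norm,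
    norm_indicatorConstLp (by norm_num) (by norm_num), norm_one, one_mul, Real.sqrt_eq_rpow]
  have h : (symmDiff (Ioc c x) (Ioc c y)) ⊆ uIoc x y := by
    intro t ht
    rw [mem_symmDiff] at ht
    rw [mem_uIoc]
    simp only [mem_Ioc] at ht
    grind
  have h2 : (volume.restrict (Ioo c d)).real (symmDiff (Ioc c x) (Ioc c y)) ≤ dist x y := by
    calc _ ≤ volume.real (uIoc x y) := by
          refine ENNReal.toReal_mono (by simp [uIoc]) ?_
          exact (Measure.restrict_apply_le _ _).trans (measure_mono h)
      _ = dist x y := by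
          rw [uIoc, Real.volume_real_Ioc_of_le (min_le_max), max_sub_min_eq_abs, Real.dist_eq,
            abs_sub_comm]
  simpa using Real.rpow_le_rpow measureReal_nonneg h2 (by norm_num : (0 : ℝ) ≤ 1 / 2)

theorem norm_cutIndicator_le (x : ℝ) : ‖cutIndicator c d x‖ ≤ √(volume.real (Ioo c d)) := by
  rw [cutIndicator, norm_indicatorConstLp (by norm_num) (by norm_num), norm_one, one_mul,
    Real.sqrt_eq_rpow]
  have h : (volume.restrict (Ioo c d)).real (Ioc c x) ≤ volume.real (Ioo c d) := by
    refine ENNReal.toReal_mono (by simp) ?_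
    rw [Measure.restrict_apply measurableSet_Ioc]
    exact measure_mono inter_subset_right
  simpa using Real.rpow_le_rpow measureReal_nonneg h (by norm_num : (0 : ℝ) ≤ 1 / 2)

theorem continuous_cutIndicator : Continuous (cutIndicator c d) := by
  refine continuous_iff_continuousAt.2 fun x => ?_
  rw [ContinuousAt, tendsto_iff_dist_tendsto_zero]
  refine squeeze_zero (fun _ => dist_nonneg) (fun y => dist_cutIndicator_le y x) ?_
  have : Tendsto (fun y => √(dist y x)) (𝓝 x) (𝓝 √(dist x x)) := by
    exact Continuous.tendsto (by fun_prop) x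
  simpa using this

/-- Writing the primitive as an inner product lets Cauchy–Schwarz supply all the estimates needed
for Arzelà–Ascoli. -/
theorem inner_cutIndicator (h : Lp ℂ 2 (volume.restrict (Ioo c d))) {x : ℝ} (hx : x ∈ Icc c d) :
    inner ℂ (cutIndicator c d x) h = ∫ t in c..x, h t := by
  rw [cutIndicator, L2.inner_indicatorConstLp_one, intervalIntegral.integral_of_le hx.1,
    Measure.restrict_restrict measurableSet_Ioc]
  -- At `x = d` the set `(c, d]` is not contained in `(c, d)`, but the extra point is null.
  rcases hx.2.eq_or_lt with rfl | hxd
  · rw [inter_eq_right.2 Ioo_subset_Ioc_self, integral_Ioc_eq_integral_Ioo]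
  · rw [inter_eq_left.2 (show Ioc c x ⊆ Ioo c d from fun t ht => ⟨ht.1, ht.2.trans_lt hxd⟩)]

/-- The primitive vanishing at `c` of an element of `L₂(c, d)`, as a continuous function. -/
noncomputable def primitiveBCF (c d : ℝ) :
    Lp ℂ 2 (volume.restrict (Ioo c d)) →L[ℂ] BoundedContinuousFunction ℝ ℂ :=
  LinearMap.mkContinuous
    { toFun := fun h => BoundedContinuousFunction.ofNormedAddCommGroup
        (fun x => inner ℂ (cutIndicator c d x) h) (continuous_cutIndicator.inner continuous_const)
        (√(volume.real (Ioo c d)) * ‖h‖) fun x => (norm_inner_le_norm _ _).trans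
          (mul_le_mul_of_nonneg_right (norm_cutIndicator_le x) (norm_nonneg h))
      map_add' := fun h g => by ext x; exact inner_add_right (𝕜 := ℂ) (cutIndicator c d x) h g
      map_smul' := fun r h => by ext x; exact inner_smul_right (𝕜 := ℂ) (cutIndicator c d x) h r }
    (√(volume.real (Ioo c d))) fun h =>
      BoundedContinuousFunction.norm_ofNormedAddCommGroup_le _ (by positivity) fun x =>
        (norm_inner_le_norm _ _).trans
          (mul_le_mul_of_nonneg_right (norm_cutIndicator_le x) (norm_nonneg h))

theorem primitiveBCF_apply (h : Lp ℂ 2 (volume.restrict (Ioo c d))) (x : ℝ) :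
    primitiveBCF c d h x = inner ℂ (cutIndicator c d x) h := rfl

/-- The Volterra operator `h ↦ ∫_c^x h` on `L₂(c, d)`. -/
noncomputable def volterra (c d : ℝ) :
    Lp ℂ 2 (volume.restrict (Ioo c d)) →L[ℂ] Lp ℂ 2 (volume.restrict (Ioo c d)) :=
  (BoundedContinuousFunction.toLp 2 _ ℂ).comp (primitiveBCF c d)

theorem volterra_ae_eq (h : Lp ℂ 2 (volume.restrict (Ioo c d))) :
    volterra c d h =ᵐ[volume.restrict (Ioo c d)] fun x => ∫ t in c..x, h t := by
  filter_upwards [BoundedContinuousFunction.coeFn_toLp 2 (volume.restrict (Ioo c d)) ℂ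
    (primitiveBCF c d h), ae_restrict_mem measurableSet_Ioo] with x hx hm
  rw [← inner_cutIndicator h (Ioo_subset_Icc_self hm), ← primitiveBCF_apply, ← hx]
  rfl

/-- Primitives of the unit ball of `L₂` are uniformly bounded and share the modulus of continuity
`√t`, so Arzelà–Ascoli makes them relatively compact in the uniform norm. The uniform norm controls
the `L₂` norm on a bounded interval. -/
theorem isCompactOperator_volterra (hcd : c ≤ d) : IsCompactOperator (volterra c d) := by
  let e : C(Icc c d, ℝ) := ⟨Subtype.val, continuous_subtype_val⟩
  let p : C(ℝ, Icc c d) := ⟨projIcc c d hcd, continuous_projIcc⟩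
  -- Arzelà–Ascoli is applied on the compact interval `[c, d]`; the projection `p` afterwards
  -- carries functions back to the line without changing them on `(c, d)`.
  let r : BoundedContinuousFunction ℝ ℂ →L[ℂ] BoundedContinuousFunction (Icc c d) ℂ :=
    LinearMap.mkContinuous
      { toFun := fun g => g.compContinuous e
        map_add' := fun _ _ => rfl
        map_smul' := fun _ _ => rfl } 1 fun g => by
      rw [one_mul]
      exact (BoundedContinuousFunction.norm_le (norm_nonneg g)).2 fun x => g.norm_coe_le_norm x
  let V0 := r.comp (primitiveBCF c d)
  have hV0 : IsCompactOperator V0 := by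
    refine (isCompactOperator_iff_isCompact_closure_image_closedBall
      (V0 : Lp ℂ 2 (volume.restrict (Ioo c d)) →ₗ[ℂ] BoundedContinuousFunction (Icc c d) ℂ)
      one_pos).2 ?_
    refine BoundedContinuousFunction.arzela_ascoli
      (Metric.closedBall 0 √(volume.real (Ioo c d))) (isCompact_closedBall _ _) _ ?_ ?_
    · rintro _ x ⟨h, hh, rfl⟩
      rw [mem_closedBall_zero_iff] at hh ⊢
      change ‖inner ℂ (cutIndicator c d x) h‖ ≤ _
      refine (norm_inner_le_norm _ _).trans ?_
      exact (mul_le_mul (norm_cutIndicator_le _) hh (norm_nonneg _) (Real.sqrt_nonneg _)).trans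
        (mul_one _).le
    · refine Metric.equicontinuous_of_continuity_modulus (fun t => √t) ?_ _ ?_
      · simpa using (Real.continuous_sqrt.tendsto 0)
      · rintro x y ⟨_, h, hh, rfl⟩
        rw [mem_closedBall_zero_iff] at hh
        change dist (inner ℂ (cutIndicator c d x) h) (inner ℂ (cutIndicator c d y) h) ≤ _
        rw [dist_eq_norm, ← inner_sub_left]
        refine (norm_inner_le_norm _ _).trans ?_
        rw [← dist_eq_norm]
        exact (mul_le_mul (dist_cutIndicator_le _ _) hh (norm_nonneg _)
          (Real.sqrt_nonneg _)).trans (mul_one _).le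
  have hcont : Continuous fun g : BoundedContinuousFunction (Icc c d) ℂ =>
      (BoundedContinuousFunction.toLp 2 (volume.restrict (Ioo c d)) ℂ) (g.compContinuous p) :=
    (ContinuousLinearMap.continuous _).comp (BoundedContinuousFunction.continuous_compContinuous p)
  have heq : (volterra c d : _ → _) = (fun g : BoundedContinuousFunction (Icc c d) ℂ =>
      (BoundedContinuousFunction.toLp 2 (volume.restrict (Ioo c d)) ℂ)
        (g.compContinuous p)) ∘ V0 := by
    funext h
    refine Lp.ext ?_
    filter_upwards [BoundedContinuousFunction.coeFn_toLp 2 (volume.restrict (Ioo c d)) ℂ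
      (primitiveBCF c d h), BoundedContinuousFunction.coeFn_toLp 2 (volume.restrict (Ioo c d)) ℂ
      ((V0 h).compContinuous p), ae_restrict_mem measurableSet_Ioo] with x h1 h2 hm
    refine Eq.trans h1 (Eq.trans ?_ h2.symm)
    change primitiveBCF c d h x = primitiveBCF c d h (projIcc c d hcd x)
    rw [projIcc_of_mem hcd (Ioo_subset_Icc_self hm)]
  rw [heq]
  exact hV0.continuous_comp hcont

end Volterra

/-! ### Functions on an open interval with one-sided limits -/

section IntervalLimits

variable {E : Type*} [NormedAddCommGroup E] {c d : ℝ}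

/-- The limits extend `f` continuously to the compact interval `[c, d]`. -/
theorem exists_bound_of_continuousOn_Ioo {f : ℝ → E} (hcd : c < d) (hf : ContinuousOn f (Ioo c d))
    (hc : ∃ l, Tendsto f (𝓝[>] c) (𝓝 l)) (hd : ∃ l, Tendsto f (𝓝[<] d) (𝓝 l)) :
    ∃ C, ∀ x ∈ Ioo c d, ‖f x‖ ≤ C := by
  obtain ⟨lc, hc⟩ := hc
  obtain ⟨ld, hd⟩ := hd
  obtain ⟨C, hC⟩ := isCompact_Icc.exists_bound_of_continuousOn
    (continuousOn_Icc_extendFrom_Ioo hf hc hd)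
  refine ⟨C, fun x hx => ?_⟩
  have := hC x (Ioo_subset_Icc_self hx)
  rwa [extendFrom_eq (by rw [closure_Ioo hcd.ne]; exact Ioo_subset_Icc_self hx) (hf x hx)] at this

theorem memLp_of_continuousOn_Ioo {f : ℝ → ℂ} (hcd : c < d) (hf : ContinuousOn f (Ioo c d))
    (hc : ∃ l, Tendsto f (𝓝[>] c) (𝓝 l)) (hd : ∃ l, Tendsto f (𝓝[<] d) (𝓝 l)) (p : ENNReal) :
    MemLp f p (volume.restrict (Ioo c d)) := by
  obtain ⟨C, hC⟩ := exists_bound_of_continuousOn_Ioo hcd hf hc hd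
  refine MemLp.of_bound (hf.aestronglyMeasurable measurableSet_Ioo) C ?_
  filter_upwards [ae_restrict_mem measurableSet_Ioo] with x hx using hC x hx

/-- The fundamental theorem of calculus for a locally absolutely continuous function with
one-sided limits at the end points. -/
theorem integral_Ioo_of_ac_of_tendsto {W w : ℝ → ℂ} (hcd : c < d)
    (hW : ∀ x ∈ Ioo c d, ∀ y ∈ Ioo c d, AbsolutelyContinuousOnInterval W x y)
    (hd : ∀ᵐ x ∂volume.restrict (Ioo c d), HasDerivAt W (w x) x)
    (hw : IntegrableOn w (Ioo c d)) {lc ld : ℂ} (hlc : Tendsto W (𝓝[>] c) (𝓝 lc))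
    (hld : Tendsto W (𝓝[<] d) (𝓝 ld)) : ∫ x in Ioo c d, w x = ld - lc := by
  have hi : IntervalIntegrable w volume c d :=
    (intervalIntegrable_iff_integrableOn_Ioo_of_le hcd.le).2 hw
  obtain ⟨m, hm⟩ : (Ioo c d).Nonempty := nonempty_Ioo.2 hcd
  have hmu : m ∈ uIcc c d := by
    rw [uIcc_of_le hcd.le]
    exact Ioo_subset_Icc_self hm
  -- Absolute continuity is available only inside the open interval, so the formula is first
  -- established from an interior point `m` and then passed to the limit at each end.
  have heq : EqOn (fun x => W x - W m) (fun x => ∫ t in m..x, w t) (Ioo c d) := fun x hx => by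
    have hs : uIcc m x ⊆ Ioo c d := ordConnected_Ioo.uIcc_subset hm hx
    refine ((hW m hm x hx).integral_eq_sub ?_ (hi.mono_set ?_)).symm
    · filter_upwards [(ae_restrict_iff' measurableSet_Ioo).1 hd] with y hy hy' using hy (hs hy')
    · rw [uIcc_of_le hcd.le]
      exact hs.trans Ioo_subset_Icc_self
  have hcont := intervalIntegral.continuousOn_primitive_interval' hi hmu
  rw [uIcc_of_le hcd.le] at hcont
  have hr : Tendsto (fun x => ∫ t in m..x, w t) (𝓝[<] d) (𝓝 (∫ t in m..d, w t)) := by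
    rw [← nhdsWithin_Ioo_eq_nhdsLT hcd]
    exact (hcont d (right_mem_Icc.2 hcd.le)).mono Ioo_subset_Icc_self
  have hl : Tendsto (fun x => ∫ t in m..x, w t) (𝓝[>] c) (𝓝 (∫ t in m..c, w t)) := by
    rw [← nhdsWithin_Ioo_eq_nhdsGT hcd]
    exact (hcont c (left_mem_Icc.2 hcd.le)).mono Ioo_subset_Icc_self
  have er := tendsto_nhds_unique hr
    ((hld.sub_const (W m)).congr' (heq.eventuallyEq_of_mem (Ioo_mem_nhdsLT hcd)))
  have el := tendsto_nhds_unique hl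
    ((hlc.sub_const (W m)).congr' (heq.eventuallyEq_of_mem (Ioo_mem_nhdsGT hcd)))
  rw [← integral_Ioc_eq_integral_Ioo, ← intervalIntegral.integral_of_le hcd.le,
    ← intervalIntegral.integral_add_adjacent_intervals (b := m)
      (hi.mono_set (uIcc_subset_uIcc_left hmu)) (hi.mono_set (uIcc_subset_uIcc_right hmu)),
    intervalIntegral.integral_symm, el, er]
  ring

end IntervalLimits

/-! ### Lagrange's identity and symmetry of the operator -/

namespace BVTProblem

variable {n : ℕ} {P : BVTProblem n} {f g : ℝ → ℂ}

theorem ρ_ne_zero (k : Fin (n + 1)) : P.ρ k ≠ 0 := fun h => by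
  have := P.ρ_sq_pos k
  simp [h] at this

theorem IsDomainFunction.continuousOn (hf : P.IsDomainFunction f) (k : Fin (n + 1)) :
    ContinuousOn f (P.interval k) := (hf.differentiableOn k).continuousOn

theorem IsDomainFunction.memLp (hf : P.IsDomainFunction f) (k : Fin (n + 1)) :
    MemLp f 2 (volume.restrict (P.interval k)) :=
  memLp_of_continuousOn_Ioo (left_lt_right k) (hf.continuousOn k) (hf.hasLimits.right k)
    (hf.hasLimits.left k) 2

/-- Lagrange's identity on a single interval. -/
theorem IsDomainFunction.integral_lagrange (hf : P.IsDomainFunction f) (hg : P.IsDomainFunction g)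
    (k : Fin (n + 1)) :
    (∫ x in P.interval k, P.ell k f x * conj (g x)) - ∫ x in P.interval k, f x * conj (P.ell k g x)
      = (P.ρ k : ℂ) ^ 2 *
      ((Function.rightLim (deriv f) (P.ξ k.castSucc) * conj (Function.rightLim g (P.ξ k.castSucc)) -
        Function.rightLim f (P.ξ k.castSucc) * conj (Function.rightLim (deriv g) (P.ξ k.castSucc)))
      - (Function.leftLim (deriv f) (P.ξ k.succ) * conj (Function.leftLim g (P.ξ k.succ)) -
        Function.leftLim f (P.ξ k.succ) * conj (Function.leftLim (deriv g) (P.ξ k.succ)))) := by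
  have hρ : (P.ρ k : ℂ) ≠ 0 := by exact_mod_cast ρ_ne_zero k
  have h1 : Integrable (fun x => P.ell k f x * conj (g x)) (volume.restrict (P.interval k)) :=
    (hf.memLp_ell k).integrable_mul (hg.memLp k).star
  have h2 : Integrable (fun x => f x * conj (P.ell k g x)) (volume.restrict (P.interval k)) :=
    (hf.memLp k).integrable_mul (hg.memLp_ell k).star
  -- This integrand is the derivative of the Wronskian `f' conj g - f conj g'`: the real potential
  -- `q` drops out, and solving for the second derivatives gives the factor `-1 / ρ ^ 2`.
  have hI := (h1.sub h2).const_mul (-((P.ρ k : ℂ) ^ 2)⁻¹)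
  have hconj : Continuous (conj : ℂ → ℂ) := Complex.continuous_conj
  have key := integral_Ioo_of_ac_of_tendsto (W := fun x => deriv f x * conj (g x) -
    f x * conj (deriv g x)) (left_lt_right k) ?_ ?_ hI
    (((hf.hasLimits.tendsto_deriv_rightLim k).mul
      ((hconj.tendsto _).comp (hg.hasLimits.tendsto_rightLim k))).sub
      ((hf.hasLimits.tendsto_rightLim k).mul
      ((hconj.tendsto _).comp (hg.hasLimits.tendsto_deriv_rightLim k))))
    (((hf.hasLimits.tendsto_deriv_leftLim k).mul
      ((hconj.tendsto _).comp (hg.hasLimits.tendsto_leftLim k))).sub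
      ((hf.hasLimits.tendsto_leftLim k).mul
      ((hconj.tendsto _).comp (hg.hasLimits.tendsto_deriv_leftLim k))))
  · simp only [Pi.sub_apply] at key
    rw [integral_const_mul, show Ioo (P.ξ k.castSucc) (P.ξ k.succ) = P.interval k from rfl,
      integral_sub h1 h2] at key
    field_simp at key
    linear_combination (-1 : ℂ) * key
  · intro x hx y hy
    exact ((hf.ac_deriv k x hx y hy).smul (hg.ac k x hx y hy).conj_comp).sub
      ((hf.ac k x hx y hy).smul (hg.ac_deriv k x hx y hy).conj_comp)
  · filter_upwards [hf.ae_differentiableAt k, hg.ae_differentiableAt k,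
      ae_restrict_mem (isOpen_interval k).measurableSet] with x hf2 hg2 hx
    have hf1 := ((hf.differentiableOn k).differentiableAt
      ((isOpen_interval k).mem_nhds hx)).hasDerivAt
    have hg1 := ((hg.differentiableOn k).differentiableAt
      ((isOpen_interval k).mem_nhds hx)).hasDerivAt
    have := (hf2.hasDerivAt.mul hg1.star).sub (hf1.mul hg2.hasDerivAt.star)
    convert! this using 1
    simp only [ell, Pi.sub_apply, map_add, map_mul, map_neg, map_pow, Complex.conj_ofReal,
      RCLike.star_def]
    field_simp
    ring

/-- The weight of an interval without the factor `1 / ρ ^ 2`. -/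
noncomputable def thetaWeight (P : BVTProblem n) (k : Fin (n + 1)) : ℝ :=
  (∏ i ∈ Finset.univ.filter (fun i : Fin n => (i : ℕ) < (k : ℕ)), P.θ i 0 1) *
    ∏ i ∈ Finset.univ.filter (fun i : Fin n => (k : ℕ) ≤ (i : ℕ)), P.θ i 2 3

theorem weight_mul_sq (k : Fin (n + 1)) : P.weight k * P.ρ k ^ 2 = P.thetaWeight k := by
  have := ρ_ne_zero (P := P) k
  rw [weight, thetaWeight]
  field_simp

theorem thetaWeight_zero : P.thetaWeight 0 = ∏ i, P.θ i 2 3 := by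
  simp [thetaWeight]

theorem thetaWeight_last : P.thetaWeight (Fin.last n) = ∏ i, P.θ i 0 1 := by
  simp [thetaWeight, Finset.filter_false_of_mem, Fin.is_lt]

/-- Passing over the point `i` only exchanges the factor `θ i 2 3` for `θ i 0 1`. This is what makes
the Wronskian terms at `i` cancel. -/
theorem exists_thetaWeight_eq (i : Fin n) : ∃ D : ℝ,
    P.thetaWeight i.castSucc = D * P.θ i 2 3 ∧ P.thetaWeight i.succ = D * P.θ i 0 1 := by
  refine ⟨(∏ j ∈ Finset.univ.filter (fun j : Fin n => (j : ℕ) < (i : ℕ)), P.θ j 0 1) *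
    ∏ j ∈ Finset.univ.filter (fun j : Fin n => (i : ℕ) + 1 ≤ (j : ℕ)), P.θ j 2 3, ?_, ?_⟩
  · have : Finset.univ.filter (fun j : Fin n => (i : ℕ) ≤ (j : ℕ)) =
        insert i (Finset.univ.filter (fun j : Fin n => (i : ℕ) + 1 ≤ (j : ℕ))) := by
      ext j
      simp only [Finset.mem_filter, Finset.mem_univ, true_and, Finset.mem_insert, Fin.ext_iff]
      omega
    simp only [thetaWeight, Fin.val_castSucc]
    rw [this, Finset.prod_insert (by simp)]
    ring
  · have : Finset.univ.filter (fun j : Fin n => (j : ℕ) < (i : ℕ) + 1) =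
        insert i (Finset.univ.filter (fun j : Fin n => (j : ℕ) < (i : ℕ))) := by
      ext j
      simp only [Finset.mem_filter, Finset.mem_univ, true_and, Finset.mem_insert, Fin.ext_iff]
      omega
    simp only [thetaWeight, Fin.val_succ]
    rw [this, Finset.prod_insert (by simp)]
    ring

theorem θ_zero_one (i : Fin n) : P.θ i 0 1 = P.δp i 1 * P.γp i 0 - P.δp i 0 * P.γp i 1 := by
  simp [θ, colMinor, Matrix.det_fin_two]

theorem θ_two_three (i : Fin n) : P.θ i 2 3 = P.δm i 1 * P.γm i 0 - P.δm i 0 * P.γm i 1 := by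
  simp [θ, colMinor, Matrix.det_fin_two]

/-- The transmission conditions relate the Wronskians on the two sides of an interior point. -/
theorem transmission_wronskian (i : Fin n) (hf₁ : P.trans₁ i f = 0) (hf₂ : P.trans₂ i f = 0)
    (hg₁ : P.trans₁ i g = 0) (hg₂ : P.trans₂ i g = 0) :
    (P.θ i 2 3 : ℂ) *
      (Function.leftLim (deriv f) (P.node i) * conj (Function.leftLim g (P.node i)) -
        Function.leftLim f (P.node i) * conj (Function.leftLim (deriv g) (P.node i))) =
    (P.θ i 0 1 : ℂ) *
      (Function.rightLim (deriv f) (P.node i) * conj (Function.rightLim g (P.node i)) -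
        Function.rightLim f (P.node i) * conj (Function.rightLim (deriv g) (P.node i))) := by
  have hg₁ := congrArg conj hg₁
  have hg₂ := congrArg conj hg₂
  simp only [trans₁, trans₂, map_add, map_mul, Complex.conj_ofReal, map_zero] at hf₁ hf₂ hg₁ hg₂
  rw [θ_zero_one, θ_two_three]
  push_cast
  generalize (Function.leftLim (deriv f) (P.node i)) = a1 at *
  generalize (Function.leftLim f (P.node i)) = a0 at *
  generalize (Function.rightLim (deriv f) (P.node i)) = b1 at *
  generalize (Function.rightLim f (P.node i)) = b0 at *
  generalize conj (Function.leftLim (deriv g) (P.node i)) = c1 at *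
  generalize conj (Function.leftLim g (P.node i)) = c0 at *
  generalize conj (Function.rightLim (deriv g) (P.node i)) = d1 at *
  generalize conj (Function.rightLim g (P.node i)) = d0 at *
  -- With `M⁻`, `M⁺` the two halves of the transmission matrix, the conditions read `M⁻ a = -M⁺ b`
  -- and `M⁻ c = -M⁺ d`. Hence `det (M⁻ a, M⁻ c) = det (M⁺ b, M⁺ d)`, and multiplicativity of the
  -- determinant gives the claim.
  linear_combination (P.γm i 1 * c1 + P.γm i 0 * c0) * hf₁ - (P.δm i 1 * c1 + P.δm i 0 * c0) * hf₂
    + (P.γp i 1 * b1 + P.γp i 0 * b0) * hg₁ - (P.δp i 1 * b1 + P.δp i 0 * b0) * hg₂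

theorem boundary_wronskian_a (f g : ℝ → ℂ) :
    P.Ba f * conj (P.Ba' g) - P.Ba' f * conj (P.Ba g) = (P.κ₁ : ℂ) *
      (Function.rightLim f P.a * conj (Function.rightLim (deriv g) P.a) -
        Function.rightLim (deriv f) P.a * conj (Function.rightLim g P.a)) := by
  simp only [Ba, Ba', κ₁, Matrix.det_fin_two_of, map_sub, map_mul, Complex.conj_ofReal]
  push_cast
  ring

theorem boundary_wronskian_b (f g : ℝ → ℂ) :
    P.Bb f * conj (P.Bb' g) - P.Bb' f * conj (P.Bb g) = (P.κ₂ : ℂ) *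
      (Function.leftLim f P.b * conj (Function.leftLim (deriv g) P.b) -
        Function.leftLim (deriv f) P.b * conj (Function.leftLim g P.b)) := by
  simp only [Bb, Bb', κ₂, Matrix.det_fin_two_of, map_sub, map_mul, Complex.conj_ofReal]
  push_cast
  ring

theorem integral_mul_conj_congr {k : Fin (n + 1)} {u v u' v' : ℝ → ℂ}
    (hu : u =ᵐ[volume.restrict (P.interval k)] u') (hv : v =ᵐ[volume.restrict (P.interval k)] v') :
    ∫ x in P.interval k, u x * conj (v x) = ∫ x in P.interval k, u' x * conj (v' x) := by
  refine integral_congr_ae ?_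
  filter_upwards [hu, hv] with x h1 h2
  rw [h1, h2]

/-- The operator is symmetric. -/
theorem isSymmetricRel_graphR (P : BVTProblem n) : P.graphR.IsSymmetricRel := by
  rintro ⟨G, G'⟩ ⟨g, hg, hG, hG'⟩ ⟨F, F'⟩ ⟨f, hf, hF, hF'⟩
  simp only [inner_eq_innerH, innerH] at *
  have h1 : ∀ k, (P.weight k : ℂ) * (∫ x in P.interval k, F'.fn k x * conj (G.fn k x)) -
      (P.weight k : ℂ) * (∫ x in P.interval k, F.fn k x * conj (G'.fn k x)) =
      (P.thetaWeight k : ℂ) *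
      (Function.rightLim (deriv f) (P.ξ k.castSucc) * conj (Function.rightLim g (P.ξ k.castSucc)) -
        Function.rightLim f (P.ξ k.castSucc) * conj (Function.rightLim (deriv g) (P.ξ k.castSucc)))
      - (P.thetaWeight k : ℂ) *
      (Function.leftLim (deriv f) (P.ξ k.succ) * conj (Function.leftLim g (P.ξ k.succ)) -
        Function.leftLim f (P.ξ k.succ) * conj (Function.leftLim (deriv g) (P.ξ k.succ))) := by
    intro k
    rw [integral_mul_conj_congr (hF'.fn_ae_eq k) (hG.fn_ae_eq k),
      integral_mul_conj_congr (hF.fn_ae_eq k) (hG'.fn_ae_eq k), ← mul_sub,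
      hf.integral_lagrange hg k, ← weight_mul_sq]
    push_cast
    ring
  -- In the sum over intervals, the right limit at `a` and the left limit at `b` are split off; the
  -- remaining terms pair up at the interior points, where they cancel.
  have h2 := Finset.sum_congr (rfl : (Finset.univ : Finset (Fin (n + 1))) = _) fun k _ => h1 k
  rw [Finset.sum_sub_distrib, Finset.sum_sub_distrib, Fin.sum_univ_succ (f := fun k =>
    (P.thetaWeight k : ℂ) * (Function.rightLim (deriv f) (P.ξ k.castSucc) *
      conj (Function.rightLim g (P.ξ k.castSucc)) - Function.rightLim f (P.ξ k.castSucc) *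
      conj (Function.rightLim (deriv g) (P.ξ k.castSucc)))), Fin.sum_univ_castSucc (f := fun k =>
    (P.thetaWeight k : ℂ) * (Function.leftLim (deriv f) (P.ξ k.succ) *
      conj (Function.leftLim g (P.ξ k.succ)) - Function.leftLim f (P.ξ k.succ) *
      conj (Function.leftLim (deriv g) (P.ξ k.succ)))),
    Finset.sum_congr rfl (g := fun i : Fin n => (P.thetaWeight i.castSucc : ℂ) *
      (Function.leftLim (deriv f) (P.ξ i.castSucc.succ) *
      conj (Function.leftLim g (P.ξ i.castSucc.succ)) - Function.leftLim f (P.ξ i.castSucc.succ) *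
      conj (Function.leftLim (deriv g) (P.ξ i.castSucc.succ)))) fun i _ => ?_,
    thetaWeight_zero, thetaWeight_last] at h2
  · have ha := boundary_wronskian_a (P := P) f g
    have hb := boundary_wronskian_b (P := P) f g
    have hκ₁ : (P.κ₁ : ℂ) ≠ 0 := by exact_mod_cast P.κ₁_pos.ne'
    have hκ₂ : (P.κ₂ : ℂ) ≠ 0 := by exact_mod_cast P.κ₂_pos.ne'
    rw [a] at ha
    rw [b] at hb
    rw [Fin.castSucc_zero, Fin.succ_last] at h2
    rw [hF.c₁_eq, hF.c₂_eq, hF'.c₁_eq, hF'.c₂_eq, hG.c₁_eq, hG.c₂_eq, hG'.c₁_eq, hG'.c₂_eq]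
    simp only [map_neg]
    rw [← sub_eq_zero]
    field_simp
    -- The end point Wronskians are those produced by `B_a, B'_a` and `B_b, B'_b` up to the factors
    -- `κ₁`, `κ₂`, which the weights of the scalar components divide out.
    linear_combination -(P.κ₁ : ℂ) * P.κ₂ * h2 - ((∏ i, P.θ i 2 3 : ℝ) : ℂ) * P.κ₂ * ha +
      ((∏ i, P.θ i 0 1 : ℝ) : ℂ) * P.κ₁ * hb
  · obtain ⟨D, hD1, hD2⟩ := exists_thetaWeight_eq (P := P) i
    have h := transmission_wronskian i (hf.transmission₁ i) (hf.transmission₂ i)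
      (hg.transmission₁ i) (hg.transmission₂ i)
    rw [node] at h
    rw [hD1, hD2, Fin.succ_castSucc]
    push_cast
    linear_combination (-(D : ℂ)) * h

end BVTProblem

/-! ### Eigenvectors of the operator and eigenfunctions of the problem -/

theorem absolutelyContinuousOnInterval_of_hasDerivAt {f f' : ℝ → ℂ} {s : Set ℝ}
    (hs : s.OrdConnected) (hf : ∀ x ∈ s, HasDerivAt f (f' x) x) (hf' : ContinuousOn f' s) {c d : ℝ}
    (hc : c ∈ s) (hd : d ∈ s) : AbsolutelyContinuousOnInterval f c d := by
  have hsub := hs.uIcc_subset hc hd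
  have hi : IntervalIntegrable f' volume c d := (hf'.mono hsub).intervalIntegrable
  refine (AbsolutelyContinuousOnInterval.of_primitive hi (left_mem_uIcc : c ∈ uIcc c d)).of_dist_le
    fun x hx y hy => le_of_eq ?_
  have h : ∀ x ∈ uIcc c d, ∫ t in c..x, f' t = f x - f c := fun x hx =>
    intervalIntegral.integral_eq_sub_of_hasDerivAt
      (fun t ht => hf t (hsub (uIcc_subset_uIcc_left hx ht)))
      (hi.mono_set (uIcc_subset_uIcc_left hx))
  rw [h x hx, h y hy, dist_sub_right]

namespace BVTProblem

variable {n : ℕ} {P : BVTProblem n} {f u : ℝ → ℂ} {lam : ℂ}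

theorem IsEigenfunction.deriv_deriv (hu : P.IsEigenfunction lam u) (k : Fin (n + 1)) :
    EqOn (deriv (deriv u)) (fun x => ((P.ρ k : ℂ) ^ 2)⁻¹ * ((P.q x - lam) * u x))
      (P.interval k) := by
  intro x hx
  have hρ : (P.ρ k : ℂ) ≠ 0 := by exact_mod_cast ρ_ne_zero (P := P) k
  have h := hu.equation k x hx
  simp only [ell] at h
  field_simp
  linear_combination -h

theorem continuousOn_q_sub_mul (lam : ℂ) (k : Fin (n + 1)) (hf : ContinuousOn f (P.interval k)) :
    ContinuousOn (fun x => ((P.ρ k : ℂ) ^ 2)⁻¹ * ((P.q x - lam) * f x)) (P.interval k) :=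
  continuousOn_const.mul (((Complex.continuous_ofReal.comp_continuousOn
    (P.q_continuousOn k)).sub continuousOn_const).mul hf)

/-- The equation expresses `u''` through `u`, so it is continuous and `u'` is continuously
differentiable; `ell u = lam u` is bounded because `u` has limits at the end points. -/
theorem IsEigenfunction.isDomainFunction (hu : P.IsEigenfunction lam u) :
    P.IsDomainFunction u where
  differentiableOn := hu.differentiableOn
  ac k _ hc _ hd := absolutelyContinuousOnInterval_of_hasDerivAt (s := P.interval k)
    ordConnected_Ioo (fun x hx => ((hu.differentiableOn k).differentiableAt
      ((isOpen_interval k).mem_nhds hx)).hasDerivAt) (hu.differentiableOn_deriv k).continuousOn hc hd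
  ac_deriv k _ hc _ hd := absolutelyContinuousOnInterval_of_hasDerivAt (s := P.interval k)
    ordConnected_Ioo (fun x hx => ((hu.differentiableOn_deriv k).differentiableAt
      ((isOpen_interval k).mem_nhds hx)).hasDerivAt)
    ((continuousOn_q_sub_mul lam k (hu.differentiableOn k).continuousOn).congr (hu.deriv_deriv k))
    hc hd
  hasLimits := hu.hasLimits
  memLp_ell k := by
    have h := memLp_of_continuousOn_Ioo (left_lt_right k) (hu.differentiableOn k).continuousOn
      (hu.hasLimits.right k) (hu.hasLimits.left k) 2
    refine (h.const_mul lam).ae_eq ?_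
    filter_upwards [ae_restrict_mem measurableSet_Ioo] with x hx using (hu.equation k x hx).symm
  transmission₁ := hu.transmission₁
  transmission₂ := hu.transmission₂

theorem IsDomainFunction.eqOn_zero_of_ae (hf : P.IsDomainFunction f) {k : Fin (n + 1)}
    (h : f =ᵐ[volume.restrict (P.interval k)] 0) : EqOn f 0 (P.interval k) :=
  Measure.eqOn_open_of_ae_eq (μ := volume) h (isOpen_interval k) (hf.continuousOn k)
    continuousOn_const

/-- By continuity `f` vanishes everywhere once it vanishes almost everywhere. Conversely, the scalar
components are limits of `f` and `f'`, so they vanish with `f`. -/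
theorem IsDomainFunction.isAugmented_eq_zero_iff (hf : P.IsDomainFunction f) {F : P.H}
    (hF : P.IsAugmented f F) : F = 0 ↔ ∀ k, EqOn f 0 (P.interval k) := by
  constructor
  · rintro rfl k
    exact hf.eqOn_zero_of_ae ((hF.fn_ae_eq k).symm.trans (Lp.coeFn_zero _ _ _))
  · intro h
    obtain ⟨-, -, -, h1, -, h2, -, -⟩ := vanish h
    refine H.ext (fun k => Lp.ext ?_) (by rw [hF.c₁_eq, h1]; rfl)
      (by rw [hF.c₂_eq, h2, neg_zero]; rfl)
    rw [H.fn_zero]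
    filter_upwards [hF.fn_ae_eq k, Lp.coeFn_zero ℂ 2 (volume.restrict (P.interval k)),
      ae_restrict_mem measurableSet_Ioo] with x h3 h4 hx
    rw [h3, h4, h k hx]

theorem IsEigenfunction.mem_graphR (hu : P.IsEigenfunction lam u) {F : P.H}
    (hF : P.IsAugmented u F) : (F, lam • F) ∈ P.graphR := by
  refine ⟨u, hu.isDomainFunction, hF, fun k => ?_, ?_, ?_⟩
  · rw [H.fn_smul]
    filter_upwards [Lp.coeFn_smul lam (F.fn k), hF.fn_ae_eq k,
      ae_restrict_mem measurableSet_Ioo] with x h1 h2 hx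
    rw [h1, Pi.smul_apply, h2, smul_eq_mul, hu.equation k x hx]
  · rw [H.c₁_smul, hF.c₁_eq]
    linear_combination -hu.boundary_a
  · rw [H.c₂_smul, hF.c₂_eq]
    linear_combination -hu.boundary_b

theorem IsEigenfunction.ne_zero (hu : P.IsEigenfunction lam u) {F : P.H}
    (hF : P.IsAugmented u F) : F ≠ 0 := fun h => by
  obtain ⟨k, x, hx, h0⟩ := hu.nontrivial
  exact h0 ((hu.isDomainFunction.isAugmented_eq_zero_iff hF).1 h k hx)

/-- A domain function satisfying the differential equation almost everywhere satisfies it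
everywhere. -/
theorem IsDomainFunction.hasDerivAt_deriv (hf : P.IsDomainFunction f) {k : Fin (n + 1)}
    (h : ∀ᵐ x ∂volume.restrict (P.interval k), P.ell k f x = lam * f x) {x : ℝ}
    (hx : x ∈ P.interval k) :
    HasDerivAt (deriv f) (((P.ρ k : ℂ) ^ 2)⁻¹ * ((P.q x - lam) * f x)) x := by
  set w : ℝ → ℂ := fun x => ((P.ρ k : ℂ) ^ 2)⁻¹ * ((P.q x - lam) * f x) with hw
  have hwc : ContinuousOn w (P.interval k) := continuousOn_q_sub_mul lam k (hf.continuousOn k)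
  have hρ : (P.ρ k : ℂ) ≠ 0 := by exact_mod_cast ρ_ne_zero (P := P) k
  have hi : ∀ y ∈ P.interval k, IntervalIntegrable w volume x y := fun y hy =>
    (hwc.mono (uIcc_subset_interval hx hy)).intervalIntegrable
  -- Since `f'` is absolutely continuous, it is the primitive of its almost everywhere derivative,
  -- which here agrees with the continuous function `w`.
  have heq : EqOn (deriv f) (fun y => deriv f x + ∫ t in x..y, w t) (P.interval k) := by
    intro y hy
    have := (hf.ac_deriv k x hx y hy).integral_eq_sub (f' := w) (by
      filter_upwards [(ae_restrict_iff' measurableSet_Ioo).1 h,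
        (ae_restrict_iff' measurableSet_Ioo).1 (hf.ae_differentiableAt k)] with t h1 h2 ht
      have ht := uIcc_subset_interval hx hy ht
      convert (h2 ht).hasDerivAt using 1
      have h1 := h1 ht
      simp only [ell] at h1
      rw [hw]
      field_simp
      linear_combination h1) (hi y hy)
    simp only [this]
    ring
  have hx' := (isOpen_interval (P := P) k).mem_nhds hx
  have h1 : HasDerivAt (fun y => ∫ t in x..y, w t) (w x) x :=
    intervalIntegral.integral_hasDerivAt_right (hi x hx)
      (hwc.stronglyMeasurableAtFilter (isOpen_interval k) x hx) (hwc.continuousAt hx')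
  exact (h1.const_add (deriv f x)).congr_of_eventuallyEq (heq.eventuallyEq_of_mem hx')

theorem exists_isEigenfunction {F : P.H} (hF0 : F ≠ 0) (hF : (F, lam • F) ∈ P.graphR) :
    ∃ u, P.IsEigenfunction lam u ∧ P.IsAugmented u F := by
  obtain ⟨f, hf, hA, hI⟩ := hF
  have hae : ∀ k, ∀ᵐ x ∂volume.restrict (P.interval k), P.ell k f x = lam * f x := fun k => by
    have h1 := hI.fn_ae_eq k
    rw [H.fn_smul] at h1
    filter_upwards [h1, Lp.coeFn_smul lam (F.fn k), hA.fn_ae_eq k] with x h2 h3 h4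
    rw [← h2, h3, Pi.smul_apply, h4, smul_eq_mul]
  have hd := fun k x (hx : x ∈ P.interval k) => hf.hasDerivAt_deriv (hae k) hx
  refine ⟨f, ⟨hf.differentiableOn, fun k x hx => (hd k x hx).differentiableAt.differentiableWithinAt,
    hf.hasLimits, fun k x hx => ?_, ?_, ?_, hf.transmission₁, hf.transmission₂, ?_⟩, hA⟩
  · have hρ : (P.ρ k : ℂ) ≠ 0 := by exact_mod_cast ρ_ne_zero (P := P) k
    rw [ell, (hd k x hx).deriv]
    field_simp
    ring
  · have h := hI.c₁_eq
    rw [H.c₁_smul, hA.c₁_eq] at h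
    rw [h, sub_self]
  · have h := hI.c₂_eq
    rw [H.c₂_smul, hA.c₂_eq] at h
    rw [← h]
    ring
  · by_contra! hcon
    exact hF0 ((hf.isAugmented_eq_zero_iff hA).2 hcon)

theorem eigenvectors_eq_relEigenvectors (P : BVTProblem n) :
    P.eigenvectors = P.graphR.relEigenvectors := by
  ext F
  refine and_congr_right fun _ => exists_congr fun c => ?_
  rw [← graph_R, LinearPMap.mem_graph_iff]
  constructor
  · rintro ⟨hF, h⟩
    exact ⟨⟨F, hF⟩, rfl, h⟩
  · rintro ⟨⟨y, hy⟩, rfl, h⟩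
    exact ⟨hy, h⟩

theorem eigenvectors_eq (P : BVTProblem n) : P.eigenvectors = {F : P.H | ∃ (lam : ℂ) (u : ℝ → ℂ),
    P.IsEigenfunction lam u ∧ P.IsAugmented u F} := by
  rw [eigenvectors_eq_relEigenvectors]
  ext F
  constructor
  · rintro ⟨hF0, c, hc⟩
    obtain ⟨u, hu⟩ := exists_isEigenfunction hF0 hc
    exact ⟨c, u, hu⟩
  · rintro ⟨c, u, hu, hF⟩
    exact ⟨hu.ne_zero hF, c, hu.mem_graphR hF⟩

end BVTProblem

/-! ### Infinite dimension and second primitives -/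

/-- Polynomials embed: one that vanishes almost everywhere on the interval vanishes at infinitely
many points. -/
theorem not_finiteDimensional_Lp {c d : ℝ} (hcd : c < d) :
    ¬ FiniteDimensional ℂ (Lp ℂ 2 (volume.restrict (Ioo c d))) := by
  intro hfin
  have hm : ∀ p : Polynomial ℂ, MemLp (fun x : ℝ => p.eval (x : ℂ)) 2 (volume.restrict (Ioo c d)) :=
    fun p => by
      have hc : Continuous fun x : ℝ => p.eval (x : ℂ) := p.continuous.comp Complex.continuous_ofReal
      exact memLp_of_continuousOn_Ioo hcd hc.continuousOn ⟨_, (hc.tendsto c).mono_left inf_le_left⟩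
        ⟨_, (hc.tendsto d).mono_left inf_le_left⟩ 2
  let T : Polynomial ℂ →ₗ[ℂ] Lp ℂ 2 (volume.restrict (Ioo c d)) :=
    { toFun := fun p => (hm p).toLp
      map_add' := fun p r => by
        rw [← MemLp.toLp_add]
        congr 1
        ext x
        simp
      map_smul' := fun a p => by
        rw [RingHom.id_apply, ← MemLp.toLp_const_smul]
        congr 1
        ext x
        simp }
  have hT : Function.Injective T := by
    rw [← LinearMap.ker_eq_bot, LinearMap.ker_eq_bot']
    intro p hp
    have h1 : (fun x : ℝ => p.eval (x : ℂ)) =ᵐ[volume.restrict (Ioo c d)] 0 :=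
      (hm p).coeFn_toLp.symm.trans (by
        change T p =ᵐ[_] _
        rw [hp]
        exact Lp.coeFn_zero _ _ _)
    have h2 : EqOn (fun x : ℝ => p.eval (x : ℂ)) 0 (Ioo c d) :=
      Measure.eqOn_open_of_ae_eq (μ := volume) h1 isOpen_Ioo
        (p.continuous.comp Complex.continuous_ofReal).continuousOn continuousOn_const
    refine Polynomial.eq_zero_of_infinite_isRoot p (Infinite.mono ?_
      ((Ioo_infinite hcd).image Complex.ofReal_injective.injOn))
    rintro _ ⟨x, hx, rfl⟩
    exact h2 hx
  have : FiniteDimensional ℂ (Polynomial ℂ) := FiniteDimensional.of_injective T hT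
  exact Polynomial.not_finite this

section DoublePrimitive

variable {c d : ℝ} {h : ℝ → ℂ}

/-- The second primitive of `h` with prescribed value and derivative at `c`. -/
noncomputable def doublePrimitive (c : ℝ) (α β : ℂ) (h : ℝ → ℂ) (x : ℝ) : ℂ :=
  α + ∫ s in c..x, (β + ∫ t in c..s, h t)

theorem continuousOn_primitive_of_intervalIntegrable (hcd : c ≤ d)
    (hh : IntervalIntegrable h volume c d) : ContinuousOn (fun x => ∫ t in c..x, h t) (Icc c d) := by
  have := intervalIntegral.continuousOn_primitive_interval' hh left_mem_uIcc
  rwa [uIcc_of_le hcd] at this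

theorem hasDerivAt_doublePrimitive (hcd : c ≤ d) (α β : ℂ) (hh : IntervalIntegrable h volume c d)
    {x : ℝ} (hx : x ∈ Ioo c d) :
    HasDerivAt (doublePrimitive c α β h) (β + ∫ t in c..x, h t) x := by
  have hc := (continuousOn_const (c := β)).add
    (continuousOn_primitive_of_intervalIntegrable hcd hh)
  refine (intervalIntegral.integral_hasDerivAt_right ?_ ?_ ?_).const_add α
  · refine (hc.mono ?_).intervalIntegrable
    rw [uIcc_of_le hx.1.le]
    exact Icc_subset_Icc_right hx.2.le
  · exact (hc.mono Ioo_subset_Icc_self).stronglyMeasurableAtFilter isOpen_Ioo x hx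
  · exact hc.continuousAt (Icc_mem_nhds hx.1 hx.2)

theorem continuousOn_doublePrimitive (hcd : c ≤ d) (α β : ℂ)
    (hh : IntervalIntegrable h volume c d) : ContinuousOn (doublePrimitive c α β h) (Icc c d) := by
  have hc := (continuousOn_const (c := β)).add
    (continuousOn_primitive_of_intervalIntegrable hcd hh)
  refine continuousOn_const.add (continuousOn_primitive_of_intervalIntegrable hcd ?_)
  rw [← uIcc_of_le hcd] at hc
  exact hc.intervalIntegrable

end DoublePrimitive

/-! ### Encoding functions by second derivatives and left end point values -/

namespace BVTProblem

variable {n : ℕ} {P : BVTProblem n}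

/-- The space `L₂(ξₖ, ξₖ₊₁)`. -/
abbrev L (P : BVTProblem n) (k : Fin (n + 1)) : Type := Lp ℂ 2 (volume.restrict (P.interval k))

/-- The space `P.H` is linearly homeomorphic to the product of its components. -/
noncomputable def equivProd (P : BVTProblem n) : ((∀ k, P.L k) × ℂ × ℂ) ≃L[ℂ] P.H :=
  LinearEquiv.toContinuousLinearEquivOfContinuous
    (LinearEquiv.refl ℂ ((∀ k, P.L k) × ℂ × ℂ) : ((∀ k, P.L k) × ℂ × ℂ) ≃ₗ[ℂ] P.H) (by
    -- One bound suffices: both spaces are complete, so the open mapping theorem makes the inverse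
    -- continuous.
    let e : ((∀ k, P.L k) × ℂ × ℂ) →ₗ[ℂ] P.H := LinearMap.id
    let D : ℝ := (∑ k, P.weight k) + P.weight₁ + P.weight₂
    have hD : 0 ≤ D := by
      have := Finset.sum_nonneg fun k (_ : k ∈ Finset.univ) => (P.weight_pos k).le
      have h1 := P.weight₁_pos
      have h2 := P.weight₂_pos
      positivity
    have hb : ∀ G, ‖e G‖ ≤ √D * ‖G‖ := by
      intro G
      refine le_of_sq_le_sq ?_ (by positivity)
      have a0 : ∀ k, ‖(e G).fn k‖ ≤ ‖G‖ := fun k => (norm_le_pi_norm G.1 k).trans (norm_fst_le G)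
      have a1 : ‖(e G).c₁‖ ≤ ‖G‖ := (norm_fst_le G.2).trans (norm_snd_le G)
      have a2 : ‖(e G).c₂‖ ≤ ‖G‖ := (norm_snd_le G.2).trans (norm_snd_le G)
      rw [P.norm_sq_eq, mul_pow, Real.sq_sqrt hD]
      simp only [D, add_mul, Finset.sum_mul]
      have h := fun k => (P.weight_pos k).le
      have h1 := P.weight₁_pos.le
      have h2 := P.weight₂_pos.le
      gcongr with k
      · exact h k
      · exact a0 k
    exact (e.mkContinuous _ hb).continuous)

instance (P : BVTProblem n) : TopologicalSpace.SeparableSpace P.H :=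
  have : Fact ((2 : ENNReal) ≠ ⊤) := ⟨ENNReal.ofNat_ne_top⟩
  have : ∀ k, SecondCountableTopology (P.L k) := fun _ => Lp.SecondCountableTopology
  P.equivProd.surjective.denseRange.separableSpace P.equivProd.continuous

theorem not_finiteDimensional_H (P : BVTProblem n) : ¬ FiniteDimensional ℂ P.H := by
  intro hfin
  refine not_finiteDimensional_Lp (P.left_lt_right 0) ?_
  let T : P.H →ₗ[ℂ] P.L 0 := LinearMap.proj 0 ∘ₗ LinearMap.fst ℂ (∀ k, P.L k) (ℂ × ℂ) ∘ₗ
    P.equivProd.symm.toLinearEquiv.toLinearMap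
  have hT : Function.Surjective T := (LinearMap.proj_surjective (R := ℂ) (φ := P.L) 0).comp
    ((LinearMap.fst_surjective (R := ℂ) (M := ∀ k, P.L k) (M₂ := ℂ × ℂ)).comp
      P.equivProd.symm.surjective)
  exact (Module.Finite.of_surjective T hT : Module.Finite ℂ (P.L 0))

theorem eq_of_mem_interval {j k : Fin (n + 1)} {x : ℝ} (hj : x ∈ P.interval j)
    (hk : x ∈ P.interval k) : j = k := by
  have aux : ∀ {j k : Fin (n + 1)}, x ∈ P.interval j → x ∈ P.interval k → ¬ j < k := by
    intro j k hj hk hjk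
    have h : P.ξ j.succ ≤ P.ξ k.castSucc := P.ξ_strictMono.monotone (by
      rw [Fin.le_def, Fin.val_succ, Fin.val_castSucc]
      exact hjk)
    exact absurd (hj.2.trans_le h) (not_lt.2 hk.1.le)
  exact le_antisymm (not_lt.1 (aux hk hj)) (not_lt.1 (aux hj hk))

/-- Parameters of a piecewise twice differentiable function: the second derivative on each
interval, and the values of the function and of its derivative at the left end points. -/
abbrev Data (P : BVTProblem n) : Type :=
  (∀ k, P.L k) × (Fin (n + 1) → ℂ) × (Fin (n + 1) → ℂ)

/-- The function with the given parameters. -/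
noncomputable def build (x : P.Data) (t : ℝ) : ℂ :=
  ∑ k, (P.interval k).indicator
    (doublePrimitive (P.ξ k.castSucc) (x.2.1 k) (x.2.2 k) (x.1 k)) t

variable (x : P.Data) (k : Fin (n + 1))

theorem build_eqOn : EqOn (build x)
    (doublePrimitive (P.ξ k.castSucc) (x.2.1 k) (x.2.2 k) (x.1 k)) (P.interval k) := by
  intro t ht
  rw [build, Finset.sum_eq_single k, indicator_of_mem ht]
  · intro j _ hj
    exact indicator_of_notMem (fun h => hj (eq_of_mem_interval h ht)) _
  · intro h
    exact absurd (Finset.mem_univ k) h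

theorem intervalIntegrable_data :
    IntervalIntegrable (x.1 k) volume (P.ξ k.castSucc) (P.ξ k.succ) :=
  intervalIntegrable_of_memLp (left_lt_right k).le (Lp.memLp (x.1 k))

theorem hasDerivAt_build {t : ℝ} (ht : t ∈ P.interval k) :
    HasDerivAt (build x) (x.2.2 k + ∫ s in P.ξ k.castSucc..t, x.1 k s) t :=
  (hasDerivAt_doublePrimitive (left_lt_right k).le _ _ (intervalIntegrable_data x k)
    ht).congr_of_eventuallyEq
    ((build_eqOn x k).eventuallyEq_of_mem ((isOpen_interval k).mem_nhds ht))

theorem deriv_build_eqOn : EqOn (deriv (build x))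
    (fun t => x.2.2 k + ∫ s in P.ξ k.castSucc..t, x.1 k s) (P.interval k) :=
  fun _ ht => (hasDerivAt_build x k ht).deriv

/-- Lebesgue's differentiation theorem for the primitive of an integrable function. -/
theorem ae_hasDerivAt_deriv_build : ∀ᵐ t ∂volume.restrict (P.interval k),
    HasDerivAt (deriv (build x)) (x.1 k t) t := by
  have h := (intervalIntegrable_data x k).ae_hasDerivAt_integral
  filter_upwards [ae_restrict_of_ae h, ae_restrict_mem measurableSet_Ioo] with t h1 ht
  rw [uIcc_of_le (left_lt_right k).le] at h1
  exact ((h1 (Ioo_subset_Icc_self ht) _ (left_mem_Icc.2 (left_lt_right k).le)).const_add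
    (x.2.2 k)).congr_of_eventuallyEq
    ((deriv_build_eqOn x k).eventuallyEq_of_mem ((isOpen_interval k).mem_nhds ht))

/-- The constant function `1` on an interval. -/
noncomputable def oneL (P : BVTProblem n) (k : Fin (n + 1)) : P.L k :=
  cutIndicator (P.ξ k.castSucc) (P.ξ k.succ) (P.ξ k.succ)

theorem oneL_ae_eq : P.oneL k =ᵐ[volume.restrict (P.interval k)] fun _ => 1 := by
  filter_upwards [indicatorConstLp_coeFn (p := 2) (hs := measurableSet_Ioc)
    (hμs := measure_ne_top (volume.restrict (Ioo (P.ξ k.castSucc) (P.ξ k.succ))) (Ioc (P.ξ k.castSucc) (P.ξ k.succ)))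
    (c := (1 : ℂ)), ae_restrict_mem measurableSet_Ioo] with t h1 ht
  exact h1.trans (indicator_of_mem (Ioo_subset_Ioc_self ht) _)

/-- The Volterra operator on an interval. -/
noncomputable def volterraL (P : BVTProblem n) (k : Fin (n + 1)) : P.L k →L[ℂ] P.L k :=
  volterra (P.ξ k.castSucc) (P.ξ k.succ)

/-- Integration over an interval. -/
noncomputable def integralL (P : BVTProblem n) (k : Fin (n + 1)) : P.L k →L[ℂ] ℂ :=
  innerSL ℂ (P.oneL k)

theorem integralL_apply (h : P.L k) :
    P.integralL k h = ∫ t in P.ξ k.castSucc..P.ξ k.succ, h t :=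
  inner_cutIndicator (c := P.ξ k.castSucc) (d := P.ξ k.succ) h
    (right_mem_Icc.2 (left_lt_right k).le)

/-- The value at the left end point of an interval. -/
noncomputable def valR (P : BVTProblem n) (k : Fin (n + 1)) : P.Data →L[ℂ] ℂ :=
  ContinuousLinearMap.proj k ∘L ContinuousLinearMap.fst ℂ _ _ ∘L ContinuousLinearMap.snd ℂ _ _

/-- The derivative at the left end point of an interval. -/
noncomputable def derR (P : BVTProblem n) (k : Fin (n + 1)) : P.Data →L[ℂ] ℂ :=
  ContinuousLinearMap.proj k ∘L ContinuousLinearMap.snd ℂ _ _ ∘L ContinuousLinearMap.snd ℂ _ _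

/-- The second derivative on an interval. -/
noncomputable def secondDeriv (P : BVTProblem n) (k : Fin (n + 1)) : P.Data →L[ℂ] P.L k :=
  ContinuousLinearMap.proj k ∘L ContinuousLinearMap.fst ℂ (∀ k, P.L k) _

/-- The first derivative on an interval. -/
noncomputable def firstDeriv (P : BVTProblem n) (k : Fin (n + 1)) : P.Data →L[ℂ] P.L k :=
  (P.derR k).smulRight (P.oneL k) + P.volterraL k ∘L P.secondDeriv k

/-- The function itself on an interval. -/
noncomputable def fnMap (P : BVTProblem n) (k : Fin (n + 1)) : P.Data →L[ℂ] P.L k :=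
  (P.valR k).smulRight (P.oneL k) + P.volterraL k ∘L P.firstDeriv k

/-- The value at the right end point of an interval. -/
noncomputable def valL (P : BVTProblem n) (k : Fin (n + 1)) : P.Data →L[ℂ] ℂ :=
  P.valR k + P.integralL k ∘L P.firstDeriv k

/-- The derivative at the right end point of an interval. -/
noncomputable def derL (P : BVTProblem n) (k : Fin (n + 1)) : P.Data →L[ℂ] ℂ :=
  P.derR k + P.integralL k ∘L P.secondDeriv k

theorem firstDeriv_ae_eq : P.firstDeriv k x =ᵐ[volume.restrict (P.interval k)]
    fun t => x.2.2 k + ∫ s in P.ξ k.castSucc..t, x.1 k s := by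
  have h1 : P.volterraL k (x.1 k) =ᵐ[volume.restrict (P.interval k)]
    fun t => ∫ s in P.ξ k.castSucc..t, x.1 k s := volterra_ae_eq _
  have h2 : P.firstDeriv k x = x.2.2 k • P.oneL k + P.volterraL k (x.1 k) := rfl
  rw [h2]
  filter_upwards [h1, oneL_ae_eq k, Lp.coeFn_add (x.2.2 k • P.oneL k) (P.volterraL k (x.1 k)),
    Lp.coeFn_smul (x.2.2 k) (P.oneL k)] with t h1 h2 h3 h4
  rw [h3, Pi.add_apply, h4, Pi.smul_apply, h2, h1, smul_eq_mul, mul_one]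

theorem integral_firstDeriv {t : ℝ} (ht : t ∈ Icc (P.ξ k.castSucc) (P.ξ k.succ)) :
    ∫ s in P.ξ k.castSucc..t, P.firstDeriv k x s =
      ∫ s in P.ξ k.castSucc..t, (x.2.2 k + ∫ r in P.ξ k.castSucc..s, x.1 k r) := by
  rw [intervalIntegral.integral_of_le ht.1, intervalIntegral.integral_of_le ht.1,
    integral_Ioc_eq_integral_Ioo, integral_Ioc_eq_integral_Ioo]
  exact integral_congr_ae (ae_restrict_of_ae_restrict_of_subset (Ioo_subset_Ioo_right ht.2)
    (firstDeriv_ae_eq x k))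

theorem fnMap_ae_eq : P.fnMap k x =ᵐ[volume.restrict (P.interval k)] build x := by
  have h1 : P.volterraL k (P.firstDeriv k x) =ᵐ[volume.restrict (P.interval k)]
    fun t => ∫ s in P.ξ k.castSucc..t, P.firstDeriv k x s := volterra_ae_eq _
  have h2 : P.fnMap k x = x.2.1 k • P.oneL k + P.volterraL k (P.firstDeriv k x) := rfl
  rw [h2]
  filter_upwards [h1, oneL_ae_eq k, Lp.coeFn_add (x.2.1 k • P.oneL k)
    (P.volterraL k (P.firstDeriv k x)), Lp.coeFn_smul (x.2.1 k) (P.oneL k),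
    ae_restrict_mem measurableSet_Ioo] with t h1 h2 h3 h4 ht
  rw [h3, Pi.add_apply, h4, Pi.smul_apply, h2, h1, smul_eq_mul, mul_one, build_eqOn x k ht,
    doublePrimitive, integral_firstDeriv x k (Ioo_subset_Icc_self ht)]

/-- A rank one operator plus a compact Volterra operator composed with a bounded one. -/
theorem isCompactOperator_fnMap : IsCompactOperator (P.fnMap k) := by
  have h1 : IsCompactOperator ((P.valR k).smulRight (P.oneL k)) :=
    (isCompactOperator_of_locallyCompactSpace_rng
      ((ContinuousLinearMap.id ℂ ℂ).smulRight (P.oneL k))).comp_clm (P.valR k)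
  have h2 : IsCompactOperator (P.volterraL k) :=
    isCompactOperator_volterra (left_lt_right k).le
  exact h1.add (h2.comp_clm (P.firstDeriv k))

theorem tendsto_build_right :
    Tendsto (build x) (𝓝[>] (P.ξ k.castSucc)) (𝓝 (P.valR k x)) := by
  have hc := continuousOn_doublePrimitive (left_lt_right k).le (x.2.1 k) (x.2.2 k)
    (intervalIntegrable_data x k) _ (left_mem_Icc.2 (left_lt_right k).le)
  have h1 : doublePrimitive (P.ξ k.castSucc) (x.2.1 k) (x.2.2 k) (x.1 k) (P.ξ k.castSucc) =
      P.valR k x := by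
    rw [doublePrimitive, intervalIntegral.integral_same, add_zero]
    rfl
  rw [← h1]
  refine Tendsto.congr' ((build_eqOn x k).symm.eventuallyEq_of_mem (interval_mem_right k)) ?_
  rw [← nhdsWithin_Ioo_eq_nhdsGT (left_lt_right k)]
  exact hc.mono Ioo_subset_Icc_self

theorem tendsto_build_left :
    Tendsto (build x) (𝓝[<] (P.ξ k.succ)) (𝓝 (P.valL k x)) := by
  have hc := continuousOn_doublePrimitive (left_lt_right k).le (x.2.1 k) (x.2.2 k)
    (intervalIntegrable_data x k) _ (right_mem_Icc.2 (left_lt_right k).le)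
  have h1 : doublePrimitive (P.ξ k.castSucc) (x.2.1 k) (x.2.2 k) (x.1 k) (P.ξ k.succ) =
      P.valL k x := by
    rw [doublePrimitive, ← integral_firstDeriv x k (right_mem_Icc.2 (left_lt_right k).le),
      ← integralL_apply]
    rfl
  rw [← h1]
  refine Tendsto.congr' ((build_eqOn x k).symm.eventuallyEq_of_mem (interval_mem_left k)) ?_
  rw [← nhdsWithin_Ioo_eq_nhdsLT (left_lt_right k)]
  exact hc.mono Ioo_subset_Icc_self

theorem tendsto_deriv_build_right :
    Tendsto (deriv (build x)) (𝓝[>] (P.ξ k.castSucc)) (𝓝 (P.derR k x)) := by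
  have hc := (continuousOn_const (c := x.2.2 k)).add (continuousOn_primitive_of_intervalIntegrable
    (left_lt_right k).le (intervalIntegrable_data x k)) _ (left_mem_Icc.2 (left_lt_right k).le)
  have h1 : x.2.2 k + ∫ s in P.ξ k.castSucc..P.ξ k.castSucc, x.1 k s = P.derR k x := by
    rw [intervalIntegral.integral_same, add_zero]
    rfl
  rw [← h1]
  refine Tendsto.congr' ((deriv_build_eqOn x k).symm.eventuallyEq_of_mem (interval_mem_right k)) ?_
  rw [← nhdsWithin_Ioo_eq_nhdsGT (left_lt_right k)]
  exact hc.mono Ioo_subset_Icc_self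

theorem tendsto_deriv_build_left :
    Tendsto (deriv (build x)) (𝓝[<] (P.ξ k.succ)) (𝓝 (P.derL k x)) := by
  have hc := (continuousOn_const (c := x.2.2 k)).add (continuousOn_primitive_of_intervalIntegrable
    (left_lt_right k).le (intervalIntegrable_data x k)) _ (right_mem_Icc.2 (left_lt_right k).le)
  have h1 : x.2.2 k + ∫ s in P.ξ k.castSucc..P.ξ k.succ, x.1 k s = P.derL k x := by
    rw [← integralL_apply]
    rfl
  rw [← h1]
  refine Tendsto.congr' ((deriv_build_eqOn x k).symm.eventuallyEq_of_mem (interval_mem_left k)) ?_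
  rw [← nhdsWithin_Ioo_eq_nhdsLT (left_lt_right k)]
  exact hc.mono Ioo_subset_Icc_self

theorem hasLimits_build : P.HasLimits (build x) :=
  ⟨fun k => ⟨_, tendsto_build_right x k⟩, fun k => ⟨_, tendsto_build_left x k⟩,
    fun k => ⟨_, tendsto_deriv_build_right x k⟩, fun k => ⟨_, tendsto_deriv_build_left x k⟩⟩

/-- `B_a` on the data space. -/
noncomputable def BaD (P : BVTProblem n) : P.Data →L[ℂ] ℂ :=
  (P.δ₁ : ℂ) • P.valR 0 - (P.δ₂ : ℂ) • P.derR 0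

/-- `B'_a` on the data space. -/
noncomputable def BaD' (P : BVTProblem n) : P.Data →L[ℂ] ℂ :=
  (P.δ₃ : ℂ) • P.valR 0 - (P.δ₄ : ℂ) • P.derR 0

/-- `B_b` on the data space. -/
noncomputable def BbD (P : BVTProblem n) : P.Data →L[ℂ] ℂ :=
  (P.γ₁ : ℂ) • P.valL (Fin.last n) - (P.γ₂ : ℂ) • P.derL (Fin.last n)

/-- `B'_b` on the data space. -/
noncomputable def BbD' (P : BVTProblem n) : P.Data →L[ℂ] ℂ :=
  (P.γ₃ : ℂ) • P.valL (Fin.last n) - (P.γ₄ : ℂ) • P.derL (Fin.last n)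

/-- The first transmission condition on the data space. -/
noncomputable def transD₁ (P : BVTProblem n) (i : Fin n) : P.Data →L[ℂ] ℂ :=
  (P.δm i 1 : ℂ) • P.derL i.castSucc + (P.δm i 0 : ℂ) • P.valL i.castSucc +
    (P.δp i 1 : ℂ) • P.derR i.succ + (P.δp i 0 : ℂ) • P.valR i.succ

/-- The second transmission condition on the data space. -/
noncomputable def transD₂ (P : BVTProblem n) (i : Fin n) : P.Data →L[ℂ] ℂ :=
  (P.γm i 1 : ℂ) • P.derL i.castSucc + (P.γm i 0 : ℂ) • P.valL i.castSucc +
    (P.γp i 1 : ℂ) • P.derR i.succ + (P.γp i 0 : ℂ) • P.valR i.succ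

theorem rightLim_build : Function.rightLim (build x) (P.ξ k.castSucc) = P.valR k x :=
  rightLim_eq_of_tendsto (tendsto_build_right x k)

theorem leftLim_build : Function.leftLim (build x) (P.ξ k.succ) = P.valL k x :=
  leftLim_eq_of_tendsto (tendsto_build_left x k)

theorem rightLim_deriv_build : Function.rightLim (deriv (build x)) (P.ξ k.castSucc) = P.derR k x :=
  rightLim_eq_of_tendsto (tendsto_deriv_build_right x k)

theorem leftLim_deriv_build : Function.leftLim (deriv (build x)) (P.ξ k.succ) = P.derL k x :=
  leftLim_eq_of_tendsto (tendsto_deriv_build_left x k)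

theorem Ba_build : P.Ba (build x) = P.BaD x := by
  have h1 := rightLim_build x 0
  have h2 := rightLim_deriv_build x 0
  rw [Fin.castSucc_zero] at h1 h2
  rw [Ba, a, h1, h2]
  rfl

theorem Ba'_build : P.Ba' (build x) = P.BaD' x := by
  have h1 := rightLim_build x 0
  have h2 := rightLim_deriv_build x 0
  rw [Fin.castSucc_zero] at h1 h2
  rw [Ba', a, h1, h2]
  rfl

theorem Bb_build : P.Bb (build x) = P.BbD x := by
  have h1 := leftLim_build x (Fin.last n)
  have h2 := leftLim_deriv_build x (Fin.last n)
  rw [Fin.succ_last] at h1 h2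
  rw [Bb, b, h1, h2]
  rfl

theorem Bb'_build : P.Bb' (build x) = P.BbD' x := by
  have h1 := leftLim_build x (Fin.last n)
  have h2 := leftLim_deriv_build x (Fin.last n)
  rw [Fin.succ_last] at h1 h2
  rw [Bb', b, h1, h2]
  rfl

theorem trans₁_build (i : Fin n) : P.trans₁ i (build x) = P.transD₁ i x := by
  have h1 := rightLim_build x i.succ
  have h2 := rightLim_deriv_build x i.succ
  have h3 := leftLim_build x i.castSucc
  have h4 := leftLim_deriv_build x i.castSucc
  rw [Fin.succ_castSucc] at h3 h4
  rw [trans₁, node, h1, h2, h3, h4]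
  rfl

theorem trans₂_build (i : Fin n) : P.trans₂ i (build x) = P.transD₂ i x := by
  have h1 := rightLim_build x i.succ
  have h2 := rightLim_deriv_build x i.succ
  have h3 := leftLim_build x i.castSucc
  have h4 := leftLim_deriv_build x i.castSucc
  rw [Fin.succ_castSucc] at h3 h4
  rw [trans₂, node, h1, h2, h3, h4]
  rfl

theorem ell_build_ae_eq : P.ell k (build x) =ᵐ[volume.restrict (P.interval k)]
    fun t => -((P.ρ k : ℂ) ^ 2) * x.1 k t + P.q t * build x t := by
  filter_upwards [ae_hasDerivAt_deriv_build x k] with t ht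
  rw [ell, ht.deriv]

/-- Regularity, limits and square integrability are automatic for a second primitive of an `L₂`
function; only the transmission conditions have to be imposed. -/
theorem isDomainFunction_build (h₁ : ∀ i, P.transD₁ i x = 0) (h₂ : ∀ i, P.transD₂ i x = 0) :
    P.IsDomainFunction (build x) where
  differentiableOn k t ht := (hasDerivAt_build x k ht).differentiableAt.differentiableWithinAt
  ac k c hc d hd := absolutelyContinuousOnInterval_of_hasDerivAt (s := P.interval k)
    ordConnected_Ioo (fun _ ht => hasDerivAt_build x k ht) (continuousOn_const.add
      ((continuousOn_primitive_of_intervalIntegrable (left_lt_right k).le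
        (intervalIntegrable_data x k)).mono Ioo_subset_Icc_self)) hc hd
  ac_deriv k c hc d hd := by
    have hi : ∀ c ∈ P.interval k, ∀ d ∈ Icc (P.ξ k.castSucc) (P.ξ k.succ),
        IntervalIntegrable (x.1 k) volume c d := fun c hc d hd =>
      (intervalIntegrable_data x k).mono_set (by
        rw [uIcc_of_le (left_lt_right k).le]
        exact ordConnected_Icc.uIcc_subset (Ioo_subset_Icc_self hc) hd)
    -- The derivative is a constant plus a primitive based at the left end point, which lies outside
    -- the open interval; rebasing at `c` leaves the increments unchanged.
    refine (AbsolutelyContinuousOnInterval.of_primitive (hi c hc d (Ioo_subset_Icc_self hd))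
      (left_mem_uIcc : c ∈ uIcc c d)).of_dist_le fun s hs t ht => le_of_eq ?_
    have hs := uIcc_subset_interval hc hd hs
    have ht := uIcc_subset_interval hc hd ht
    have hl := (hi c hc _ (left_mem_Icc.2 (left_lt_right k).le))
    rw [deriv_build_eqOn x k hs, deriv_build_eqOn x k ht, dist_add_left,
      ← intervalIntegral.integral_add_adjacent_intervals hl.symm
        (hi c hc s (Ioo_subset_Icc_self hs)),
      ← intervalIntegral.integral_add_adjacent_intervals hl.symm
        (hi c hc t (Ioo_subset_Icc_self ht)), dist_add_left]
  hasLimits := hasLimits_build x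
  memLp_ell k := by
    refine MemLp.ae_eq (ell_build_ae_eq x k).symm ?_
    refine ((Lp.memLp (x.1 k)).const_mul _).add ?_
    have hq : ContinuousOn (fun t => (P.q t : ℂ)) (P.interval k) :=
      Complex.continuous_ofReal.comp_continuousOn (P.q_continuousOn k)
    have hb : ContinuousOn (build x) (P.interval k) := fun t ht =>
      (hasDerivAt_build x k ht).continuousAt.continuousWithinAt
    obtain ⟨l, hl⟩ := P.q_limit_right k
    obtain ⟨r, hr⟩ := P.q_limit_left k
    exact memLp_of_continuousOn_Ioo (left_lt_right k) (hq.mul hb)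
      ⟨_, ((Complex.continuous_ofReal.tendsto l).comp hl).mul (tendsto_build_right x k)⟩
      ⟨_, ((Complex.continuous_ofReal.tendsto r).comp hr).mul (tendsto_build_left x k)⟩ 2
  transmission₁ i := by rw [trans₁_build, h₁]
  transmission₂ i := by rw [trans₂_build, h₂]

end BVTProblem

/-! ### The compact resolvent -/

theorem IsCompactOperator.prod_mk {X Y Z : Type*} [NormedAddCommGroup X] [NormedSpace ℂ X]
    [NormedAddCommGroup Y] [NormedSpace ℂ Y] [NormedAddCommGroup Z] [NormedSpace ℂ Z]
    {A : X →L[ℂ] Y} {B : X →L[ℂ] Z} (hA : IsCompactOperator A) (hB : IsCompactOperator B) :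
    IsCompactOperator (A.prod B) := by
  have h : (A.prod B : X → Y × Z) = ContinuousLinearMap.inl ℂ Y Z ∘ A +
      ContinuousLinearMap.inr ℂ Y Z ∘ B := by
    funext x
    simp
  rw [h]
  exact (hA.clm_comp _).add (hB.clm_comp _)

theorem IsCompactOperator.pi_mk {ι : Type*} [Fintype ι] [DecidableEq ι] {X : Type*} {Y : ι → Type*}
    [NormedAddCommGroup X] [NormedSpace ℂ X] [∀ i, NormedAddCommGroup (Y i)]
    [∀ i, NormedSpace ℂ (Y i)] {A : ∀ i, X →L[ℂ] Y i} (hA : ∀ i, IsCompactOperator (A i)) :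
    IsCompactOperator (ContinuousLinearMap.pi A) := by
  have h : ∀ s : Finset ι, IsCompactOperator
      (∑ i ∈ s, (ContinuousLinearMap.single ℂ Y i) ∘L A i : X →L[ℂ] ∀ i, Y i) := by
    intro s
    induction s using Finset.induction_on with
    | empty => exact isCompactOperator_zero
    | insert i s hi ih =>
      rw [Finset.sum_insert hi]
      exact ((hA i).clm_comp (ContinuousLinearMap.single ℂ Y i)).add ih
  convert h Finset.univ using 2
  ext x i
  simp [Finset.sum_apply]

theorem isCompactOperator_of_finiteDimensional_range {X Y : Type*} [NormedAddCommGroup X]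
    [NormedSpace ℂ X] [NormedAddCommGroup Y] [NormedSpace ℂ Y] [FiniteDimensional ℂ Y]
    (A : X →L[ℂ] Y) : IsCompactOperator A := by
  have : LocallyCompactSpace Y := LocallyCompactSpace.of_finiteDimensional_of_complete ℂ Y
  exact (isCompactOperator_of_locallyCompactSpace_rng (ContinuousLinearMap.id ℂ Y)).comp_clm A

namespace BVTProblem

variable {n : ℕ} {P : BVTProblem n}

theorem memLp_potential (P : BVTProblem n) (μ : ℝ) (k : Fin (n + 1)) :
    MemLp (fun t => ((P.ρ k : ℂ) ^ 2)⁻¹ * ((P.q t : ℂ) - μ)) ⊤ (volume.restrict (P.interval k)) := by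
  have hq : ContinuousOn (fun t => (P.q t : ℂ)) (P.interval k) :=
    Complex.continuous_ofReal.comp_continuousOn (P.q_continuousOn k)
  obtain ⟨l, hl⟩ := P.q_limit_right k
  obtain ⟨r, hr⟩ := P.q_limit_left k
  exact memLp_of_continuousOn_Ioo (left_lt_right k)
    (continuousOn_const.mul (hq.sub continuousOn_const))
    ⟨_, (((Complex.continuous_ofReal.tendsto l).comp hl).sub_const (μ : ℂ)).const_mul _⟩
    ⟨_, (((Complex.continuous_ofReal.tendsto r).comp hr).sub_const (μ : ℂ)).const_mul _⟩ ⊤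

/-- Multiplication by `(q - μ) / ρ ^ 2` on an interval. -/
noncomputable def mulL (P : BVTProblem n) (μ : ℝ) (k : Fin (n + 1)) : P.L k →L[ℂ] P.L k :=
  (ContinuousLinearMap.mul ℂ ℂ).holderL (volume.restrict (P.interval k)) ⊤ 2 2
    (P.memLp_potential μ k).toLp

theorem mulL_ae_eq (μ : ℝ) (k : Fin (n + 1)) (h : P.L k) :
    P.mulL μ k h =ᵐ[volume.restrict (P.interval k)]
      fun t => ((P.ρ k : ℂ) ^ 2)⁻¹ * ((P.q t : ℂ) - μ) * h t := by
  filter_upwards [(ContinuousLinearMap.mul ℂ ℂ).coeFn_holder (r := 2)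
    (P.memLp_potential μ k).toLp h, (P.memLp_potential μ k).coeFn_toLp] with t h1 h2
  refine h1.trans ?_
  rw [h2]
  rfl

/-- The first halves of the boundary and transmission conditions. -/
noncomputable def cond₁ (P : BVTProblem n) (μ : ℝ) : Fin (n + 1) → P.Data →L[ℂ] ℂ :=
  Fin.cons (P.BaD - (μ : ℂ) • P.BaD') P.transD₁

/-- The second halves of the boundary and transmission conditions. -/
noncomputable def cond₂ (P : BVTProblem n) (μ : ℝ) : Fin (n + 1) → P.Data →L[ℂ] ℂ :=
  Fin.cons (P.BbD + (μ : ℂ) • P.BbD') P.transD₂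

/-- The compact operator for which `1 - T` sends the data of `u` to the data of the
boundary value problem solved by `u`. -/
noncomputable def dataOp (P : BVTProblem n) (μ : ℝ) : P.Data →L[ℂ] P.Data :=
  (ContinuousLinearMap.pi fun k => P.mulL μ k ∘L P.fnMap k).prod
    ((ContinuousLinearMap.pi fun k => P.valR k - P.cond₁ μ k).prod
      (ContinuousLinearMap.pi fun k => P.derR k - P.cond₂ μ k))

/-- The `L₂` components are compact because `fnMap` is and multiplication by the bounded potential
is continuous; the others take values in a finite-dimensional space. -/
theorem isCompactOperator_dataOp (μ : ℝ) : IsCompactOperator (P.dataOp μ) :=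
  (IsCompactOperator.pi_mk fun k => (isCompactOperator_fnMap k).clm_comp (P.mulL μ k)).prod_mk
    (isCompactOperator_of_finiteDimensional_range _)

/-- The right-hand side of the boundary value problem as an element of the data space. -/
noncomputable def rhsMap (P : BVTProblem n) : P.H →L[ℂ] P.Data :=
  ((ContinuousLinearMap.pi fun k => (-((P.ρ k : ℂ) ^ 2)⁻¹) •
      (ContinuousLinearMap.proj k ∘L ContinuousLinearMap.fst ℂ (∀ k, P.L k) (ℂ × ℂ))).prod
    ((ContinuousLinearMap.pi (Fin.cons (ContinuousLinearMap.fst ℂ ℂ ℂ ∘L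
      ContinuousLinearMap.snd ℂ (∀ k, P.L k) (ℂ × ℂ)) 0)).prod
    (ContinuousLinearMap.pi (Fin.cons (ContinuousLinearMap.snd ℂ ℂ ℂ ∘L
      ContinuousLinearMap.snd ℂ (∀ k, P.L k) (ℂ × ℂ)) 0)))) ∘L
    (P.equivProd.symm : P.H →L[ℂ] (∀ k, P.L k) × ℂ × ℂ)

/-- The element of `P.H` determined by the function with given data. -/
noncomputable def augment (P : BVTProblem n) : P.Data →L[ℂ] P.H :=
  (P.equivProd : ((∀ k, P.L k) × ℂ × ℂ) →L[ℂ] P.H) ∘L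
    (ContinuousLinearMap.pi P.fnMap).prod (P.BaD'.prod (-P.BbD'))

theorem isCompactOperator_augment : IsCompactOperator P.augment :=
  ((IsCompactOperator.pi_mk isCompactOperator_fnMap).prod_mk
    (isCompactOperator_of_finiteDimensional_range (P.BaD'.prod (-P.BbD')))).clm_comp
    (P.equivProd : ((∀ k, P.L k) × ℂ × ℂ) →L[ℂ] P.H)

theorem isAugmented_augment (x : P.Data) : P.IsAugmented (build x) (P.augment x) where
  fn_ae_eq k := fnMap_ae_eq x k
  c₁_eq := (Ba'_build x).symm
  c₂_eq := congrArg Neg.neg (Bb'_build x).symm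

section Solve

variable {μ : ℝ} {x : P.Data} {G : P.H} (h : x - P.dataOp μ x = P.rhsMap G)

include h

/-- This is the differential equation `-ρ u'' + q u = μ u + g` divided by `-ρ ^ 2`, with `ρ ^ 2` the
leading coefficient on the interval. -/
theorem data_eq (k : Fin (n + 1)) :
    x.1 k - P.mulL μ k (P.fnMap k x) = -((P.ρ k : ℂ) ^ 2)⁻¹ • G.fn k :=
  congrFun (congrArg Prod.fst h) k

/-- The operator subtracts the condition from the coordinate `valR`, so `1 - T` returns the
condition itself. Index `0` is the boundary condition with right-hand side `G.c₁`; the successors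
are the homogeneous transmission conditions. -/
theorem cond₁_eq (k : Fin (n + 1)) :
    P.cond₁ μ k x = (Fin.cons G.c₁ 0 : Fin (n + 1) → ℂ) k := by
  have h1 : P.valR k x - (P.valR k x - P.cond₁ μ k x) = _ :=
    congrFun (congrArg (fun y => y.2.1) h) k
  rw [sub_sub_cancel] at h1
  rw [h1]
  refine Fin.cases rfl (fun i => rfl) k

theorem cond₂_eq (k : Fin (n + 1)) :
    P.cond₂ μ k x = (Fin.cons G.c₂ 0 : Fin (n + 1) → ℂ) k := by
  have h1 : P.derR k x - (P.derR k x - P.cond₂ μ k x) = _ :=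
    congrFun (congrArg (fun y => y.2.2) h) k
  rw [sub_sub_cancel] at h1
  rw [h1]
  refine Fin.cases rfl (fun i => rfl) k

theorem isDomainFunction_of_data_eq : P.IsDomainFunction (build x) :=
  isDomainFunction_build x (fun i => cond₁_eq h i.succ) (fun i => cond₂_eq h i.succ)

theorem isImage_of_data_eq : P.IsImage (build x) ((μ : ℂ) • P.augment x + G) where
  fn_ae_eq k := by
    have hρ : (P.ρ k : ℂ) ≠ 0 := by exact_mod_cast ρ_ne_zero (P := P) k
    have h1 : x.1 k = P.mulL μ k (P.fnMap k x) + -((P.ρ k : ℂ) ^ 2)⁻¹ • G.fn k := by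
      rw [← data_eq h k, add_sub_cancel]
    rw [H.fn_add, H.fn_smul]
    filter_upwards [ell_build_ae_eq x k, mulL_ae_eq μ k (P.fnMap k x), fnMap_ae_eq x k,
      Lp.coeFn_add (P.mulL μ k (P.fnMap k x)) (-((P.ρ k : ℂ) ^ 2)⁻¹ • G.fn k),
      Lp.coeFn_smul (-((P.ρ k : ℂ) ^ 2)⁻¹) (G.fn k),
      Lp.coeFn_add ((μ : ℂ) • (P.augment x).fn k) (G.fn k),
      Lp.coeFn_smul (μ : ℂ) ((P.augment x).fn k),
      (isAugmented_augment x).fn_ae_eq k] with t e1 e2 e3 e4 e5 e6 e7 e8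
    rw [e1, e6, Pi.add_apply, e7, Pi.smul_apply, e8, h1, e4, Pi.add_apply, e5, e2, Pi.smul_apply,
      e3]
    simp only [smul_eq_mul]
    field_simp
    ring
  c₁_eq := by
    have h1 : P.BaD x - (μ : ℂ) * P.BaD' x = G.c₁ := cond₁_eq h 0
    rw [H.c₁_add, H.c₁_smul, (isAugmented_augment x).c₁_eq, Ba_build, Ba'_build, ← h1]
    ring
  c₂_eq := by
    have h1 : P.BbD x + (μ : ℂ) * P.BbD' x = G.c₂ := cond₂_eq h 0
    rw [H.c₂_add, H.c₂_smul, (isAugmented_augment x).c₂_eq, Bb_build, Bb'_build, ← h1]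
    ring

theorem mem_graphR_of_data_eq : (P.augment x, (μ : ℂ) • P.augment x + G) ∈ P.graphR :=
  ⟨build x, isDomainFunction_of_data_eq h, isAugmented_augment x, isImage_of_data_eq h⟩

end Solve

/-- A fixed point encodes a solution of the homogeneous problem at `μ`, so its function is zero. The
data are then recovered from the function: values and derivatives as one-sided limits, the second
derivative from the equation. -/
theorem eq_zero_of_dataOp_eq {μ : ℝ} (hμ : ∀ F, (F, (μ : ℂ) • F) ∈ P.graphR → F = 0)
    {x : P.Data} (hx : P.dataOp μ x = x) : x = 0 := by
  have h : x - P.dataOp μ x = P.rhsMap 0 := by rw [hx, sub_self, map_zero]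
  have h0 : P.augment x = 0 := hμ _ (by simpa using mem_graphR_of_data_eq h)
  have hz := ((isDomainFunction_of_data_eq h).isAugmented_eq_zero_iff (isAugmented_augment x)).1 h0
  have hfn : ∀ k, P.fnMap k x = 0 := fun k => congrArg (fun F => H.fn F k) h0
  refine Prod.ext (funext fun k => ?_) (Prod.ext (funext fun k => ?_) (funext fun k => ?_))
  · have := data_eq h k
    rw [hfn, map_zero, sub_zero, H.fn_zero, smul_zero] at this
    exact this
  · exact tendsto_nhds_unique (tendsto_build_right x k)
      (tendsto_const_nhds.congr' ((hz k).symm.eventuallyEq_of_mem (interval_mem_right k)))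
  · have hd : EqOn (deriv (build x)) 0 (P.interval k) := fun t ht => by
      rw [((hz k).eventuallyEq_of_mem ((isOpen_interval k).mem_nhds ht)).deriv_eq]
      simp
    exact tendsto_nhds_unique (tendsto_deriv_build_right x k)
      (tendsto_const_nhds.congr' (hd.symm.eventuallyEq_of_mem (interval_mem_right k)))

/-- The operator has a compact resolvent at every real number that is not an eigenvalue. -/
theorem exists_compact_resolvent {μ : ℝ} (hμ : ∀ F, (F, (μ : ℂ) • F) ∈ P.graphR → F = 0) :
    ∃ K : P.H →L[ℂ] P.H, IsCompactOperator K ∧ ∀ G, (K G, (μ : ℂ) • K G + G) ∈ P.graphR := by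
  obtain ⟨S, hS⟩ := (isCompactOperator_dataOp (P := P) μ).exists_right_inverse
    fun x hx => eq_zero_of_dataOp_eq hμ hx
  -- The inverse `S` of `1 - T` is merely bounded; compactness comes from `augment`, which contains
  -- the integrations.
  exact ⟨P.augment ∘L S ∘L P.rhsMap, isCompactOperator_augment.comp_clm (S ∘L P.rhsMap),
    fun G => mem_graphR_of_data_eq (hS (P.rhsMap G))⟩

theorem span_maximal_eigenset_dense {S : Set P.H} (hS : P.IsMaximalOrthonormalEigenset S) :
    (Submodule.span ℂ S).topologicalClosure = ⊤ := by
  obtain ⟨μ, hμ⟩ := (isSymmetricRel_graphR P).exists_not_eigenvalue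
  obtain ⟨K, hK, hKΓ⟩ := exists_compact_resolvent hμ
  rw [IsMaximalOrthonormalEigenset, eigenvectors_eq_relEigenvectors] at hS
  exact (isSymmetricRel_graphR P).span_maximal_eigenset_dense P.graphR_functional hμ hK hKΓ hS

theorem IsAugmented.innerH_eq {f : ℝ → ℂ} {G : P.H} (hG : P.IsAugmented f G) (F : P.H) :
    inner ℂ G F = (∑ k, (P.weight k : ℂ) * (∫ x in P.interval k, F.fn k x * conj (f x))) +
      ((∏ i, P.θ i 2 3 : ℝ) : ℂ) * (F.c₁ * conj (P.Ba' f) / P.κ₁) +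
      ((∏ i, P.θ i 0 1 : ℝ) : ℂ) * (F.c₂ * conj (-P.Bb' f) / P.κ₂) := by
  rw [inner_eq_innerH, innerH, hG.c₁_eq, hG.c₂_eq]
  congr 3
  funext k
  rw [integral_mul_conj_congr (ae_eq_refl _) (hG.fn_ae_eq k)]

end BVTProblem

/-! ### Completeness and the expansion -/

theorem mainTheorem4 (n : ℕ) (P : BVTProblem n) :
    P.eigenvectors = {F : P.H | ∃ (lam : ℂ) (u : ℝ → ℂ),
      P.IsEigenfunction lam u ∧ P.IsAugmented u F} ∧
    (∃ S : Set P.H, P.IsMaximalOrthonormalEigenset S) ∧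
    ∀ S : Set P.H, P.IsMaximalOrthonormalEigenset S →
      S.Countable ∧ S.Infinite ∧
      (Submodule.span ℂ S).topologicalClosure = ⊤ ∧
      ∀ Ψ : ℕ → P.H, Function.Injective Ψ → Set.range Ψ = S →
        ∃ (lam : ℕ → ℂ) (ψ : ℕ → ℝ → ℂ),
          (∀ s, P.IsEigenfunction (lam s) (ψ s) ∧ P.IsAugmented (ψ s) (Ψ s)) ∧
          ∀ F : P.H, HasSum
            (fun s =>
              ((∑ k, (P.weight k : ℂ) *
                  (∫ x in P.interval k, F.fn k x * conj (ψ s x))) +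
                ((∏ i, P.θ i 2 3 : ℝ) : ℂ) * (F.c₁ * conj (P.Ba' (ψ s)) / P.κ₁) +
                ((∏ i, P.θ i 0 1 : ℝ) : ℂ) * (F.c₂ * conj (-P.Bb' (ψ s)) / P.κ₂)) • Ψ s)
            F := by
  refine ⟨P.eigenvectors_eq, exists_maximal_orthonormal_subset _, fun S hS => ?_⟩
  have hdense := BVTProblem.span_maximal_eigenset_dense hS
  refine ⟨hS.1.2.countable_of_separable, infinite_of_span_dense P.not_finiteDimensional_H hdense,
    hdense, fun Ψ hinj hrange => ?_⟩
  have hΨ : ∀ s, ∃ (lam : ℂ) (u : ℝ → ℂ), P.IsEigenfunction lam u ∧ P.IsAugmented u (Ψ s) :=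
    fun s => by
      have h := hS.1.1 (hrange ▸ mem_range_self s)
      rwa [P.eigenvectors_eq] at h
  choose lam ψ hψ using hΨ
  refine ⟨lam, ψ, hψ, fun F => ?_⟩
  have ho : Orthonormal ℂ Ψ := by
    have h := hS.1.2
    rw [← hrange] at h
    exact (orthonormal_subtype_range hinj).1 h
  -- An orthonormal family with dense span is a Hilbert basis. Its coefficients are inner products
  -- with `Ψ s`, in which the class of `Ψ s` may be replaced by the eigenfunction `ψ s`.
  let b := HilbertBasis.mk ho (by rw [hrange, hdense])
  have hsum := b.hasSum_repr F
  simp only [HilbertBasis.repr_apply_apply, b, HilbertBasis.coe_mk] at hsum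
  exact hsum.congr_fun fun s => by rw [(hψ s).2.innerH_eq F]
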